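/- Let $\mathbb{k}$ be a field of characteristic zero, and write $(x,y,z)=(xy)z-x(yz)$. A (left) Novikov algebra is a $\mathbb{k}$-vector space with a bilinear product satisfying $(x,y,z)=(x,z,y)$ and $x(yz)=y(xz)$. For $(\gamma,\delta)\in\mathbb{k}^2\setminus\{(0,0)\}$, let $\mathcal{Q}_{\gamma,\delta}$ be the quotient of the symmetric operad of Novikov algebras by the operadic ideal generated by (the multilinear form of) the identity $$\gamma\bigl((a,a,b)-(b,a,a)\bigr)+\delta\bigl(a(ab)-a(ba)\bigr)=0.$$ Then for every $n\ge 3$, $$\dim_{\mathbb{k}}\mathcal{Q}_{1,-1}(n)=\dim_{\mathbb{k}}\mathcal{Q}_{1,0}(n)=\dim_{\mathbb{k}}\mathcal{Q}_{0,1}(n)=n+1.$$ -/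

import Mathlib

open scoped BigOperators

namespace NovOperad

noncomputable section

/-- The multiset of leaf labels of a nonassociative monomial (a binary tree with labelled leaves),
i.e. its multidegree. -/
def leaves {X : Type} : FreeMagma X → Multiset X
  | FreeMagma.of x => {x}
  | FreeMagma.mul s t => leaves s + leaves t

/-- The absolutely free (nonunital, nonassociative) algebra over `k` on the set `X`. Its basis is
the set of nonassociative monomials in the elements of `X`. -/
abbrev Free (k : Type*) [Field k] (X : Type) : Type _ := FreeNonUnitalNonAssocAlgebra k X

/-- The span of all monomials of multidegree `d` in the free algebra. -/
def homogeneous (k : Type*) [Field k] {X : Type} (d : Multiset X) : Submodule k (Free k X) :=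
  Submodule.span k {m | ∃ t : FreeMagma X, leaves t = d ∧ m = MonoidAlgebra.single t 1}

/-- The arity `n` component of the magmatic operad (the free operad on one binary operation without
symmetries): the multilinear elements, of multidegree `(1, …, 1)`, of the free algebra on the
variables `x 0, …, x (n - 1)`. -/
abbrev Mag (k : Type*) [Field k] (n : ℕ) : Type _ :=
  homogeneous k (Finset.univ : Finset (Fin n)).val

variable {k : Type*} [Field k]

theorem of_mem {X : Type} (x : X) :
    FreeNonUnitalNonAssocAlgebra.of k x ∈ homogeneous k ({x} : Multiset X) :=
  Submodule.subset_span ⟨FreeMagma.of x, rfl, rfl⟩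

theorem mul_mem {X : Type} {d e : Multiset X} {u v : Free k X}
    (hu : u ∈ homogeneous k d) (hv : v ∈ homogeneous k e) : u * v ∈ homogeneous k (d + e) := by
  unfold homogeneous at hu hv
  induction hu using Submodule.span_induction with
  | zero => simp
  | add a b _ _ ha hb => rw [add_mul]; exact add_mem ha hb
  | smul c a _ ha => rw [smul_mul_assoc]; exact Submodule.smul_mem _ _ ha
  | mem a ha =>
    obtain ⟨s, hs, rfl⟩ := ha
    induction hv using Submodule.span_induction with
    | zero => simp
    | add a b _ _ ha hb => rw [mul_add]; exact add_mem ha hb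
    | smul c a _ ha => rw [mul_smul_comm]; exact Submodule.smul_mem _ _ ha
    | mem a ha =>
      obtain ⟨t, ht, rfl⟩ := ha
      refine Submodule.subset_span ⟨s * t, ?_, ?_⟩
      · change leaves s + leaves t = d + e
        rw [hs, ht]
      · rw [MonoidAlgebra.single_mul_single, one_mul]

/-- Substitution of elements of the free algebra on `Y` for the variables in `X`. -/
def subst {X Y : Type} (y : X → Free k Y) (u : Free k X) : Free k Y :=
  FreeNonUnitalNonAssocAlgebra.lift k y u

theorem lift_single_mul {X Y : Type} (y : X → Free k Y) (s t : FreeMagma X) :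
    FreeNonUnitalNonAssocAlgebra.lift k y (MonoidAlgebra.single (s * t) 1) =
      FreeNonUnitalNonAssocAlgebra.lift k y (MonoidAlgebra.single s 1) *
        FreeNonUnitalNonAssocAlgebra.lift k y (MonoidAlgebra.single t 1) := by
  rw [← map_mul, MonoidAlgebra.single_mul_single, one_mul]

theorem subst_mem {X Y : Type} {y : X → Free k Y} {D : X → Multiset Y}
    (hy : ∀ x, y x ∈ homogeneous k (D x)) {d : Multiset X} {u : Free k X}
    (hu : u ∈ homogeneous k d) : subst y u ∈ homogeneous k (d.bind D) := by
  unfold subst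
  unfold homogeneous at hu
  induction hu using Submodule.span_induction with
  | zero => simp
  | add a b _ _ ha hb => rw [map_add]; exact add_mem ha hb
  | smul c a _ ha => rw [map_smul]; exact Submodule.smul_mem _ _ ha
  | mem a ha =>
    obtain ⟨s, rfl, rfl⟩ := ha
    induction s using FreeMagma.recOnMul with
    | ih1 x =>
      have h : FreeNonUnitalNonAssocAlgebra.lift k y (MonoidAlgebra.single (FreeMagma.of x) 1)
          = y x := FreeNonUnitalNonAssocAlgebra.lift_of_apply k y x
      rw [h]
      simpa [leaves] using hy x
    | ih2 s t hs ht =>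
      rw [lift_single_mul]
      change _ ∈ homogeneous k ((leaves s + leaves t).bind D)
      rw [Multiset.add_bind]
      exact mul_mem hs ht

theorem bind_univ {m n : ℕ} {a : Fin m → ℕ} (e : (Σ i, Fin (a i)) ≃ Fin n) :
    ((Finset.univ : Finset (Fin m)).val.bind fun i =>
      ((Finset.univ : Finset (Fin (a i))).val.bind fun j => ({e ⟨i, j⟩} : Multiset (Fin n)))) =
      (Finset.univ : Finset (Fin n)).val := by
  have h : (Finset.univ : Finset (Fin n)) =
      ((Finset.univ : Finset (Fin m)).sigma
        fun i => (Finset.univ : Finset (Fin (a i)))).map e.toEmbedding := by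
    rw [Finset.univ_sigma_univ, Finset.map_univ_equiv]
  rw [h, Finset.map_val]
  have h' : ((Finset.univ : Finset (Fin m)).sigma
      fun i => (Finset.univ : Finset (Fin (a i)))).val =
      (Finset.univ : Finset (Fin m)).val.bind
        fun i => (Finset.univ : Finset (Fin (a i))).val.map (Sigma.mk i) := rfl
  rw [h', Multiset.map_bind]
  simp only [Multiset.map_map, Multiset.bind_singleton]
  rfl

/-- The composition `u (v 0, …, v (m - 1))` of the magmatic operad: the variable `x i` of `u` is
replaced by `v i`, where the variables of all the `v i` are made disjoint and renamed by means of
an arbitrary bijection `e` with the set `Fin n` of variables. The choice of `e` incorporates the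
actions of the symmetric groups (take all `v i` equal to the operad unit `x 0` of arity `1` for the
action itself). -/
def comp {m n : ℕ} {a : Fin m → ℕ} (e : (Σ i, Fin (a i)) ≃ Fin n)
    (u : Mag k m) (v : ∀ i, Mag k (a i)) : Mag k n :=
  ⟨subst (fun i => subst (fun j => FreeNonUnitalNonAssocAlgebra.of k (e ⟨i, j⟩))
      (v i : Free k (Fin (a i)))) (u : Free k (Fin m)), by
    have h := subst_mem (k := k)
      (fun i => subst_mem (k := k) (fun j => of_mem (k := k) (e ⟨i, j⟩)) (v i).2) u.2
    rwa [bind_univ e] at h⟩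

variable (k) in
/-- An ideal of the magmatic operad: a family of subspaces of its components such that a
composition belongs to the family as soon as one of the composed elements does. (By the choice of
the bijection `e` this includes stability under the symmetric groups.) -/
structure OperadIdeal where
  carrier : ∀ n : ℕ, Submodule k (Mag k n)
  comp_outer : ∀ {m n : ℕ} {a : Fin m → ℕ} (e : (Σ i, Fin (a i)) ≃ Fin n)
    (u : Mag k m) (v : ∀ i, Mag k (a i)), u ∈ carrier m → comp e u v ∈ carrier n
  comp_inner : ∀ {m n : ℕ} {a : Fin m → ℕ} (e : (Σ i, Fin (a i)) ≃ Fin n)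
    (u : Mag k m) (v : ∀ i, Mag k (a i)) (i : Fin m), v i ∈ carrier (a i) →
      comp e u v ∈ carrier n

/-- The ideal generated by a set `S` of elements of the magmatic operad (each given together with
its arity): the intersection of all ideals containing `S`. -/
def idealSpan (S : Set (Σ n : ℕ, Mag k n)) : OperadIdeal k where
  carrier n := ⨅ (I : OperadIdeal k) (_ : ∀ r ∈ S, r.2 ∈ I.carrier r.1), I.carrier n
  comp_outer e u v hu := by
    simp only [Submodule.mem_iInf] at hu ⊢
    exact fun I hI => I.comp_outer e u v (hu I hI)
  comp_inner e u v i hv := by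
    simp only [Submodule.mem_iInf] at hv ⊢
    exact fun I hI => I.comp_inner e u v i (hv I hI)

/-- The variable `x i`, for `i = 0, 1, 2`. -/
abbrev x (k : Type*) [Field k] (i : Fin 3) : Free k (Fin 3) := FreeNonUnitalNonAssocAlgebra.of k i

theorem left_mem {i j l : Fin 3}
    (h : ({i} + {j} + {l} : Multiset (Fin 3)) = (Finset.univ : Finset (Fin 3)).val) :
    x k i * x k j * x k l ∈ homogeneous k (Finset.univ : Finset (Fin 3)).val := by
  rw [← h]
  exact mul_mem (mul_mem (of_mem i) (of_mem j)) (of_mem l)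

theorem right_mem {i j l : Fin 3}
    (h : ({i} + {j} + {l} : Multiset (Fin 3)) = (Finset.univ : Finset (Fin 3)).val) :
    x k i * (x k j * x k l) ∈ homogeneous k (Finset.univ : Finset (Fin 3)).val := by
  rw [← h, add_assoc]
  exact mul_mem (of_mem i) (mul_mem (of_mem j) (of_mem l))

theorem associator_mem {i j l : Fin 3}
    (h : ({i} + {j} + {l} : Multiset (Fin 3)) = (Finset.univ : Finset (Fin 3)).val) :
    associator (x k i) (x k j) (x k l) ∈ homogeneous k (Finset.univ : Finset (Fin 3)).val :=
  sub_mem (left_mem h) (right_mem h)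

variable (k) in
/-- The identity `(a₀, a₁, a₂) = (a₀, a₂, a₁)`, where `(a, b, c) = (a b) c - a (b c)`. -/
def rightSymmetry : Mag k 3 :=
  ⟨associator (x k 0) (x k 1) (x k 2) - associator (x k 0) (x k 2) (x k 1),
    sub_mem (associator_mem (by decide)) (associator_mem (by decide))⟩

variable (k) in
/-- The identity `a₀ (a₁ a₂) = a₁ (a₀ a₂)`. -/
def leftCommutativity : Mag k 3 :=
  ⟨x k 0 * (x k 1 * x k 2) - x k 1 * (x k 0 * x k 2),
    sub_mem (right_mem (by decide)) (right_mem (by decide))⟩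

/-- The multilinear form (polarization in `a`, with `a ↦ a₀, a₁` and `b ↦ a₂`) of the identity
`γ ((a, a, b) - (b, a, a)) + δ (a (a b) - a (b a)) = 0`. -/
def extraIdentity (γ δ : k) : Mag k 3 :=
  ⟨γ • ((associator (x k 0) (x k 1) (x k 2) + associator (x k 1) (x k 0) (x k 2))
        - (associator (x k 2) (x k 0) (x k 1) + associator (x k 2) (x k 1) (x k 0)))
    + δ • ((x k 0 * (x k 1 * x k 2) + x k 1 * (x k 0 * x k 2))
        - (x k 0 * (x k 2 * x k 1) + x k 1 * (x k 2 * x k 0))),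
    add_mem
      (Submodule.smul_mem _ _ (sub_mem
        (add_mem (associator_mem (by decide)) (associator_mem (by decide)))
        (add_mem (associator_mem (by decide)) (associator_mem (by decide)))))
      (Submodule.smul_mem _ _ (sub_mem
        (add_mem (right_mem (by decide)) (right_mem (by decide)))
        (add_mem (right_mem (by decide)) (right_mem (by decide)))))⟩

variable (k) in
/-- The defining relations of the operad of (left) Novikov algebras, as a quotient of the magmatic
operad. -/
def novikovRelations : Set (Σ n : ℕ, Mag k n) :=
  {⟨3, rightSymmetry k⟩, ⟨3, leftCommutativity k⟩}

/-- The kernel of the projection from the magmatic operad onto the operad `Q_{γ,δ}`: the ideal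
generated by the Novikov relations and the additional identity. -/
def idealQ (γ δ : k) : OperadIdeal k :=
  idealSpan (novikovRelations k ∪ {⟨3, extraIdentity γ δ⟩})

/-- The component of arity `n` of the operad `Q_{γ,δ}`, the quotient of the operad of Novikov
algebras by the ideal generated by
`γ ((a, a, b) - (b, a, a)) + δ (a (a b) - a (b a)) = 0`. -/
abbrev Q (γ δ : k) (n : ℕ) : Type _ := Mag k n ⧸ (idealQ γ δ).carrier n

end

end NovOperad

/-! Let (a,b,c) be the associator. For fixed a, b, c, the expression f(a,b,c) = γ(a,b,c) - δ b(ca)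
is symmetric in b, c by the Novikov identities. The extra identity then says f(a,b,c) + f(b,a,c) =
f(c,a,b) + f(c,b,a), which makes f totally symmetric once 3 is invertible (`IsQAlgebra.symm`). So
the associator is totally symmetric for (1,0), a(bc) is for (0,1), and (a,b,c) + b(ca) is for
(1,-1).

Upper bounds: a fully symmetric expression through which left multiplications pass freely depends
only on its multidegree (`apply₃_lift_eq_leftIter`). For (1,0) the monomials span the n right combs
x₁(x₂(⋯x)), one for each last leaf, and a single associator class. For (0,1) a monomial is one of n
left combs, one for each head, or else a value u(vw), and all of the latter coincide. For (1,-1) an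
associator with first entry x depends only on x, giving n classes D x; the right comb ending in x
plus D x does not depend on x, giving one further class K.

Lower bounds: explicit algebras record, for a multilinear monomial, the last leaf and the length of
the right spine (1,0), the head of a left comb (0,1), or the left depth of every leaf (1,-1). These
values span n + 1 dimensions. Characteristic zero serves only the upper bounds, where 2 and 3 are
inverted.

The bridge with operads: algebras satisfying the identities annihilate the operadic ideal
(`IsQAlgebra.idealQ_le`), and a relatively free algebra loses nothing of the multilinear part
(`mem_carrier_of_mem_verbal`), so both bounds become computations in algebras. -/

namespace NovOperad

noncomputable section

section OperadIdeals

variable {k : Type*} [Field k]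

/-! ### Operadic ideals from identities of algebras -/

section Identities

variable {B : Type*} [NonUnitalNonAssocRing B] [Module k B] [IsScalarTower k B B]
  [SMulCommClass k B B]

theorem lift_single {X : Type} (b : X → B) (t : FreeMagma X) :
    FreeNonUnitalNonAssocAlgebra.lift k b (MonoidAlgebra.single t 1) = FreeMagma.lift b t := by
  induction t using FreeMagma.recOnMul with
  | ih1 x => exact FreeNonUnitalNonAssocAlgebra.lift_of_apply k b x
  | ih2 s t hs ht =>
    rw [map_mul, ← hs, ← ht, ← map_mul, MonoidAlgebra.single_mul_single, one_mul]

theorem lift_subst {X Y : Type} (b : Y → B) (y : X → Free k Y) (u : Free k X) :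
    FreeNonUnitalNonAssocAlgebra.lift k b (subst y u) =
      FreeNonUnitalNonAssocAlgebra.lift k
        (fun i => FreeNonUnitalNonAssocAlgebra.lift k b (y i)) u := by
  have h : (FreeNonUnitalNonAssocAlgebra.lift k b).comp (FreeNonUnitalNonAssocAlgebra.lift k y) =
      FreeNonUnitalNonAssocAlgebra.lift k
        (fun i => FreeNonUnitalNonAssocAlgebra.lift k b (y i)) := by
    refine FreeNonUnitalNonAssocAlgebra.hom_ext k fun i => ?_
    rw [NonUnitalAlgHom.comp_apply]
    simp only [FreeNonUnitalNonAssocAlgebra.lift_of_apply]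
  exact DFunLike.congr_fun h u

theorem lift_comp {m n : ℕ} {a : Fin m → ℕ} (e : (Σ i, Fin (a i)) ≃ Fin n)
    (u : Mag k m) (v : ∀ i, Mag k (a i)) (b : Fin n → B) :
    FreeNonUnitalNonAssocAlgebra.lift k b (comp e u v : Free k (Fin n)) =
      FreeNonUnitalNonAssocAlgebra.lift k (fun i =>
        FreeNonUnitalNonAssocAlgebra.lift k (fun j => b (e ⟨i, j⟩)) (v i : Free k (Fin (a i))))
        (u : Free k (Fin m)) := by
  change FreeNonUnitalNonAssocAlgebra.lift k b (subst _ _) = _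
  rw [lift_subst]
  congr 2
  funext i
  rw [lift_subst]
  simp

/-- Every variable occurs in each monomial of a multilinear element, so one zero argument kills
every term. This makes the identities of an algebra stable under inner composition. -/
theorem lift_eq_zero_of_apply_eq_zero {m : ℕ} (u : Mag k m) (b : Fin m → B) (i : Fin m)
    (hi : b i = 0) : FreeNonUnitalNonAssocAlgebra.lift k b (u : Free k (Fin m)) = 0 := by
  obtain ⟨u, hu⟩ := u
  change FreeNonUnitalNonAssocAlgebra.lift k b u = 0
  unfold homogeneous at hu
  induction hu using Submodule.span_induction with
  | zero => simp
  | add a b _ _ ha hb => rw [map_add, ha, hb, add_zero]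
  | smul c a _ ha => rw [map_smul, ha, smul_zero]
  | mem a ha =>
    obtain ⟨t, ht, rfl⟩ := ha
    have hmem : i ∈ leaves t := by rw [ht]; exact Finset.mem_univ i
    clear ht
    rw [lift_single]
    induction t using FreeMagma.recOnMul with
    | ih1 x =>
      obtain rfl : i = x := by simpa [leaves] using hmem
      exact hi
    | ih2 s t hs ht =>
      have hmem' : i ∈ leaves s + leaves t := hmem
      rw [map_mul]
      rcases Multiset.mem_add.1 hmem' with h | h
      · rw [hs h, zero_mul]
      · rw [ht h, mul_zero]

variable (k B) in
/-- The ideal of multilinear identities of an algebra. -/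
def identityIdeal : OperadIdeal k where
  carrier n :=
    { carrier := {u | ∀ b : Fin n → B,
        FreeNonUnitalNonAssocAlgebra.lift k b (u : Free k (Fin n)) = 0}
      zero_mem' := fun b => by simp
      add_mem' := fun {u v} hu hv b => by
        rw [Submodule.coe_add, map_add, hu b, hv b, add_zero]
      smul_mem' := fun c u hu b => by
        rw [Submodule.coe_smul, map_smul, hu b, smul_zero] }
  comp_outer e u v hu b := by
    rw [lift_comp]
    exact hu _
  comp_inner e u v i hv b := by
    rw [lift_comp]
    exact lift_eq_zero_of_apply_eq_zero _ _ i (hv _)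

end Identities

theorem idealSpan_le {S : Set (Σ n : ℕ, Mag k n)} {I : OperadIdeal k}
    (h : ∀ r ∈ S, r.2 ∈ I.carrier r.1) (n : ℕ) : (idealSpan S).carrier n ≤ I.carrier n :=
  iInf₂_le I h

theorem mem_idealSpan {S : Set (Σ n : ℕ, Mag k n)} {n : ℕ} {u : Mag k n}
    (hu : (⟨n, u⟩ : Σ n : ℕ, Mag k n) ∈ S) : u ∈ (idealSpan S).carrier n := by
  simp only [idealSpan, Submodule.mem_iInf]
  exact fun I hI => hI _ hu

/-! ### Relatively free algebras -/

section Verbal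

variable (I : OperadIdeal k) (X : Type)

/-- The span of all values of elements of an operadic ideal on monomials. -/
def verbal : Submodule k (Free k X) :=
  Submodule.span k {f | ∃ (m : ℕ) (u : Mag k m), u ∈ I.carrier m ∧ ∃ v : Fin m → FreeMagma X,
    f = subst (fun i => MonoidAlgebra.single (v i) 1) (u : Free k (Fin m))}

variable {I X}

/-- The arities of the factors of `x 0 * u` with `u` of arity `m`. -/
def leftMulArity (m : ℕ) : Fin 2 → ℕ
  | 0 => 1
  | 1 => m

/-- The factors of `x 0 * u`. -/
def leftMulFactors {m : ℕ} (u : Mag k m) : ∀ i, Mag k (leftMulArity m i)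
  | 0 => ⟨FreeNonUnitalNonAssocAlgebra.of k (0 : Fin 1), of_mem (k := k) (0 : Fin 1)⟩
  | 1 => u

/-- The product of two variables. -/
def binaryMul (k : Type*) [Field k] (i j : Fin 2) (h : ({i} + {j} : Multiset (Fin 2)) =
    (Finset.univ : Finset (Fin 2)).val) : Mag k 2 :=
  ⟨FreeNonUnitalNonAssocAlgebra.of k i * FreeNonUnitalNonAssocAlgebra.of k j, by
    rw [← h]; exact mul_mem (of_mem i) (of_mem j)⟩

/-- Multiplying a value of u by a monomial, on either side, gives a value of an operadic composition
of a binary product with u, which stays in the ideal. Hence the verbal subspace is a two-sided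
ideal. The indices i, j treat both sides at once. -/
theorem exists_lift_binaryMul {m : ℕ} {u : Mag k m} (hu : u ∈ I.carrier m) (w : FreeMagma X)
    (v : Fin m → FreeMagma X) (i j : Fin 2) (h : ({i} + {j} : Multiset (Fin 2)) =
    (Finset.univ : Finset (Fin 2)).val) :
    ∃ (l : ℕ) (u' : Mag k l), u' ∈ I.carrier l ∧ ∃ v' : Fin l → FreeMagma X,
      subst (fun i => MonoidAlgebra.single (v' i) 1) (u' : Free k (Fin l)) =
        (![MonoidAlgebra.single w 1, subst (fun i => MonoidAlgebra.single (v i) 1)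
          (u : Free k (Fin m))] : Fin 2 → Free k X) i *
        (![MonoidAlgebra.single w 1, subst (fun i => MonoidAlgebra.single (v i) 1)
          (u : Free k (Fin m))] : Fin 2 → Free k X) j := by
  let e := Fintype.equivFin (Σ i, Fin (leftMulArity m i))
  let V : (Σ i, Fin (leftMulArity m i)) → FreeMagma X := fun p => match p with
    | ⟨0, _⟩ => w
    | ⟨1, q⟩ => v q
  refine ⟨_, comp e (binaryMul k i j h) (leftMulFactors u), I.comp_inner e _ _ 1 hu,
    fun l => V (e.symm l), ?_⟩
  unfold subst
  rw [lift_comp]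
  have key : (fun i => FreeNonUnitalNonAssocAlgebra.lift k
      (fun j => (MonoidAlgebra.single (V (e.symm (e ⟨i, j⟩))) 1 : Free k X))
      (leftMulFactors u i : Free k (Fin (leftMulArity m i)))) =
      (![MonoidAlgebra.single w 1, subst (fun i => MonoidAlgebra.single (v i) 1)
          (u : Free k (Fin m))] : Fin 2 → Free k X) := by
    funext i
    simp only [Equiv.symm_apply_apply]
    fin_cases i
    · exact FreeNonUnitalNonAssocAlgebra.lift_of_apply k _ _
    · rfl
  rw [key]
  simp only [binaryMul, map_mul, FreeNonUnitalNonAssocAlgebra.lift_of_apply]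
  rfl

theorem mul_mem_verbal (f : Free k X) {g : Free k X} (hg : g ∈ verbal I X) :
    f * g ∈ verbal I X ∧ g * f ∈ verbal I X := by
  induction f using MonoidAlgebra.induction_linear with
  | zero => simp
  | add f₁ f₂ h₁ h₂ =>
    rw [add_mul, mul_add]
    exact ⟨add_mem h₁.1 h₂.1, add_mem h₁.2 h₂.2⟩
  | single w r =>
    have hr : (MonoidAlgebra.single w r : Free k X) = r • MonoidAlgebra.single w 1 := by
      rw [MonoidAlgebra.smul_single, smul_eq_mul, mul_one]
    rw [hr, smul_mul_assoc, mul_smul_comm]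
    suffices h : (MonoidAlgebra.single w 1 * g : Free k X) ∈ verbal I X ∧
        (g * MonoidAlgebra.single w 1 : Free k X) ∈ verbal I X from
      ⟨Submodule.smul_mem _ _ h.1, Submodule.smul_mem _ _ h.2⟩
    unfold verbal at hg
    induction hg using Submodule.span_induction with
    | zero => simp
    | add f₁ f₂ _ _ h₁ h₂ =>
      rw [add_mul, mul_add]
      exact ⟨add_mem h₁.1 h₂.1, add_mem h₁.2 h₂.2⟩
    | smul c f _ h =>
      rw [smul_mul_assoc, mul_smul_comm]
      exact ⟨Submodule.smul_mem _ _ h.1, Submodule.smul_mem _ _ h.2⟩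
    | mem f h =>
      obtain ⟨m, u, hu, v, rfl⟩ := h
      constructor
      · obtain ⟨l, u', hu', v', h'⟩ := exists_lift_binaryMul hu w v 0 1 (by decide)
        exact Submodule.subset_span ⟨l, u', hu', v', h'.symm⟩
      · obtain ⟨l, u', hu', v', h'⟩ := exists_lift_binaryMul hu w v 1 0 (by decide)
        exact Submodule.subset_span ⟨l, u', hu', v', h'.symm⟩

variable (I X) in
/-- The relatively free algebra on `X` of the operad with ideal of relations `I`. -/
def RelFree : Type _ := Free k X ⧸ verbal I X

instance : AddCommGroup (RelFree I X) := inferInstanceAs (AddCommGroup (Free k X ⧸ verbal I X))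

instance : Module k (RelFree I X) := inferInstanceAs (Module k (Free k X ⧸ verbal I X))

variable (I X) in
/-- The projection from the free algebra onto the relatively free one. -/
def toRelFree : Free k X →ₗ[k] RelFree I X := (verbal I X).mkQ

theorem toRelFree_surjective : Function.Surjective (toRelFree I X) := Submodule.mkQ_surjective _

theorem toRelFree_eq_zero {f : Free k X} : toRelFree I X f = 0 ↔ f ∈ verbal I X :=
  Submodule.Quotient.mk_eq_zero _

theorem toRelFree_eq {f g : Free k X} : toRelFree I X f = toRelFree I X g ↔ f - g ∈ verbal I X :=
  Submodule.Quotient.eq _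

instance : Mul (RelFree I X) where
  mul a b := Quotient.liftOn₂' a b (fun f g => toRelFree I X (f * g)) (by
    intro f₁ g₁ f₂ g₂ hf hg
    rw [Submodule.quotientRel_def] at hf hg
    rw [toRelFree_eq]
    have : f₁ * g₁ - f₂ * g₂ = (f₁ - f₂) * g₁ + f₂ * (g₁ - g₂) := by
      rw [sub_mul, mul_sub]; abel
    rw [this]
    exact add_mem (mul_mem_verbal _ hf).2 (mul_mem_verbal _ hg).1)

theorem toRelFree_mul (f g : Free k X) :
    toRelFree I X (f * g) = toRelFree I X f * toRelFree I X g := rfl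

instance : NonUnitalNonAssocRing (RelFree I X) :=
  { (inferInstance : AddCommGroup (RelFree I X)), (inferInstance : Mul (RelFree I X)) with
    left_distrib := fun a b c => by
      obtain ⟨a, rfl⟩ := toRelFree_surjective a
      obtain ⟨b, rfl⟩ := toRelFree_surjective b
      obtain ⟨c, rfl⟩ := toRelFree_surjective c
      simp only [← map_add, ← toRelFree_mul, mul_add]
    right_distrib := fun a b c => by
      obtain ⟨a, rfl⟩ := toRelFree_surjective a
      obtain ⟨b, rfl⟩ := toRelFree_surjective b
      obtain ⟨c, rfl⟩ := toRelFree_surjective c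
      simp only [← map_add, ← toRelFree_mul, add_mul]
    zero_mul := fun a => by
      obtain ⟨a, rfl⟩ := toRelFree_surjective a
      rw [← map_zero (toRelFree I X), ← toRelFree_mul, zero_mul]
    mul_zero := fun a => by
      obtain ⟨a, rfl⟩ := toRelFree_surjective a
      rw [← map_zero (toRelFree I X), ← toRelFree_mul, mul_zero] }

instance : IsScalarTower k (RelFree I X) (RelFree I X) where
  smul_assoc c a b := by
    obtain ⟨a, rfl⟩ := toRelFree_surjective a
    obtain ⟨b, rfl⟩ := toRelFree_surjective b
    simp only [smul_eq_mul, ← map_smul, ← toRelFree_mul, smul_mul_assoc]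

instance : SMulCommClass k (RelFree I X) (RelFree I X) where
  smul_comm c a b := by
    obtain ⟨a, rfl⟩ := toRelFree_surjective a
    obtain ⟨b, rfl⟩ := toRelFree_surjective b
    simp only [smul_eq_mul, ← map_smul, ← toRelFree_mul, mul_smul_comm]

variable (I X) in
/-- The generators of the relatively free algebra. -/
def gen (x : X) : RelFree I X := toRelFree I X (FreeNonUnitalNonAssocAlgebra.of k x)

theorem toRelFree_single (t : FreeMagma X) :
    toRelFree I X (MonoidAlgebra.single t 1) = FreeMagma.lift (gen I X) t := by
  induction t using FreeMagma.recOnMul with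
  | ih1 x => rfl
  | ih2 s t hs ht =>
    rw [map_mul, ← hs, ← ht, ← toRelFree_mul, MonoidAlgebra.single_mul_single, one_mul]

end Verbal

/-! ### Multihomogeneous components and recovery of the operadic ideal -/

section Projection

/-- The projection of the free algebra onto a multihomogeneous component. -/
def homogeneousProj (k : Type*) [Field k] {X : Type} (d : Multiset X) :
    Free k X →ₗ[k] Free k X := by
  classical exact
  { toFun := fun f => MonoidAlgebra.ofCoeff (f.coeff.filter fun t => leaves t = d)
    map_add' := fun f g => by
      rw [MonoidAlgebra.coeff_add, Finsupp.filter_add, MonoidAlgebra.ofCoeff_add]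
    map_smul' := fun c f => by
      rw [MonoidAlgebra.coeff_smul, Finsupp.filter_smul, MonoidAlgebra.ofCoeff_smul]
      rfl }

variable {X : Type} {d e : Multiset X}

theorem homogeneousProj_single (t : FreeMagma X) (h : leaves t = d) :
    homogeneousProj k d (MonoidAlgebra.single t 1) = MonoidAlgebra.single t 1 := by
  classical
  change MonoidAlgebra.ofCoeff (Finsupp.filter (fun t => leaves t = d) (Finsupp.single t 1)) = _
  rw [Finsupp.filter_single_of_pos (fun t => leaves t = d) h]
  rfl

theorem homogeneousProj_single_ne (t : FreeMagma X) (h : leaves t ≠ d) :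
    homogeneousProj k d (MonoidAlgebra.single t 1) = 0 := by
  classical
  change MonoidAlgebra.ofCoeff (Finsupp.filter (fun t => leaves t = d) (Finsupp.single t 1)) = _
  rw [Finsupp.filter_single_of_neg (fun t => leaves t = d) h]
  rfl

theorem homogeneousProj_of_mem {f : Free k X} (hf : f ∈ homogeneous k d) :
    homogeneousProj k d f = f := by
  unfold homogeneous at hf
  induction hf using Submodule.span_induction with
  | zero => simp
  | add a b _ _ ha hb => rw [map_add, ha, hb]
  | smul c a _ ha => rw [map_smul, ha]
  | mem a ha =>
    obtain ⟨t, ht, rfl⟩ := ha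
    exact homogeneousProj_single t ht

theorem homogeneousProj_of_mem_ne {f : Free k X} (hf : f ∈ homogeneous k e) (h : e ≠ d) :
    homogeneousProj k d f = 0 := by
  unfold homogeneous at hf
  induction hf using Submodule.span_induction with
  | zero => simp
  | add a b _ _ ha hb => rw [map_add, ha, hb, add_zero]
  | smul c a _ ha => rw [map_smul, ha, smul_zero]
  | mem a ha =>
    obtain ⟨t, ht, rfl⟩ := ha
    exact homogeneousProj_single_ne t (ht.trans_ne h)

end Projection

/-- Numbering the leaf positions exhibits any monomial, even with repeated letters, as a relabelling
of a multilinear one; operadic composition accepts only the latter. -/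
theorem exists_standard {X : Type} (t : FreeMagma X) :
    ∃ (c : ℕ) (s : FreeMagma (Fin c)) (φ : Fin c → X),
      leaves s = (Finset.univ : Finset (Fin c)).val ∧ FreeMagma.map φ s = t ∧
        (Finset.univ : Finset (Fin c)).val.map φ = leaves t := by
  have hmap : ∀ {Y Z : Type} (f : Y → Z) (s : FreeMagma Y),
      leaves (FreeMagma.map f s) = (leaves s).map f := by
    intro Y Z f s
    induction s using FreeMagma.recOnMul with
    | ih1 x => rfl
    | ih2 s t hs ht =>
      rw [map_mul]
      change leaves _ + leaves _ = (leaves s + leaves t).map f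
      rw [hs, ht, Multiset.map_add]
  have hcomp : ∀ {Y Z W : Type} (f : Y → Z) (g : Z → W) (s : FreeMagma Y),
      FreeMagma.map g (FreeMagma.map f s) = FreeMagma.map (g ∘ f) s := by
    intro Y Z W f g s
    induction s using FreeMagma.recOnMul with
    | ih1 x => rfl
    | ih2 s t hs ht => simp only [map_mul, hs, ht]
  suffices h : ∃ (c : ℕ) (s : FreeMagma (Fin c)) (φ : Fin c → X),
      leaves s = (Finset.univ : Finset (Fin c)).val ∧ FreeMagma.map φ s = t by
    obtain ⟨c, s, φ, hs, hφ⟩ := h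
    exact ⟨c, s, φ, hs, hφ, by rw [← hφ, hmap, hs]⟩
  induction t using FreeMagma.recOnMul with
  | ih1 x => exact ⟨1, FreeMagma.of 0, fun _ => x, rfl, rfl⟩
  | ih2 t₁ t₂ h₁ h₂ =>
    obtain ⟨c₁, s₁, φ₁, hs₁, rfl⟩ := h₁
    obtain ⟨c₂, s₂, φ₂, hs₂, rfl⟩ := h₂
    refine ⟨c₁ + c₂, FreeMagma.map (Fin.castAdd c₂) s₁ * FreeMagma.map (Fin.natAdd c₁) s₂,
      Fin.append φ₁ φ₂, ?_, ?_⟩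
    · change leaves _ + leaves _ = _
      rw [hmap, hmap, hs₁, hs₂]
      refine ((Multiset.Nodup.ext ?_ (Finset.univ : Finset (Fin (c₁ + c₂))).nodup).2 ?_)
      · refine Multiset.nodup_add.2 ⟨?_, ?_, ?_⟩
        · exact Finset.univ.nodup.map (Fin.castAdd_injective _ _)
        · exact Finset.univ.nodup.map (Fin.natAdd_injective _ _)
        · rw [Multiset.disjoint_left]
          intro a ha hb
          obtain ⟨i, -, rfl⟩ := Multiset.mem_map.1 ha
          obtain ⟨j, -, hj⟩ := Multiset.mem_map.1 hb
          have := congrArg Fin.val hj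
          simp at this
          omega
      · intro a
        refine ⟨fun _ => Finset.mem_univ a, fun _ => ?_⟩
        rw [Multiset.mem_add, Multiset.mem_map, Multiset.mem_map]
        refine Fin.addCases (fun i => Or.inl ⟨i, Finset.mem_univ i, rfl⟩)
          (fun i => Or.inr ⟨i, Finset.mem_univ i, rfl⟩) a
    · rw [map_mul, hcomp, hcomp]
      congr 2
      · congr 1; funext i; simp
      · congr 1; funext i; simp

theorem subst_mem_carrier {I : OperadIdeal k} {m n : ℕ} {u : Mag k m} (hu : u ∈ I.carrier m)
    (v : Fin m → FreeMagma (Fin n))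
    (hv : (Finset.univ : Finset (Fin m)).val.bind (fun i => leaves (v i)) =
      (Finset.univ : Finset (Fin n)).val) :
    ∃ w ∈ I.carrier n, (w : Free k (Fin n)) =
      subst (fun i => MonoidAlgebra.single (v i) 1) (u : Free k (Fin m)) := by
  choose c s φ hs hφ hl using fun i => exists_standard (v i)
  let f : (Σ i, Fin (c i)) → Fin n := fun p => φ p.1 p.2
  -- The labels of all leaves run through each element of `Fin n` exactly once; this turns the
  -- relabelling f into the bijection required by `comp`.
  have hf : (Finset.univ : Finset (Σ i, Fin (c i))).val.map f =
      (Finset.univ : Finset (Fin n)).val := by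
    rw [← hv, ← Finset.univ_sigma_univ]
    change ((Finset.univ : Finset (Fin m)).val.bind
        fun i => (Finset.univ : Finset (Fin (c i))).val.map (Sigma.mk i)).map f = _
    rw [Multiset.map_bind]
    simp only [Multiset.map_map]
    congr 1
    funext i
    exact hl i
  have hsurj : Function.Surjective f := by
    intro y
    have : y ∈ (Finset.univ : Finset (Σ i, Fin (c i))).val.map f := by
      rw [hf]; exact Finset.mem_univ y
    obtain ⟨p, -, hp⟩ := Multiset.mem_map.1 this
    exact ⟨p, hp⟩
  have hcard : Fintype.card (Σ i, Fin (c i)) = Fintype.card (Fin n) := by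
    have := congrArg Multiset.card hf
    rwa [Multiset.card_map] at this
  let e := Equiv.ofBijective f ((Fintype.bijective_iff_surjective_and_card f).2 ⟨hsurj, hcard⟩)
  refine ⟨comp e u fun i => ⟨MonoidAlgebra.single (s i) 1,
    Submodule.subset_span ⟨s i, hs i, rfl⟩⟩, I.comp_outer _ _ _ hu, ?_⟩
  change subst _ _ = _
  congr 1
  funext i
  change FreeNonUnitalNonAssocAlgebra.lift k (fun j => FreeNonUnitalNonAssocAlgebra.of k (φ i j))
    (MonoidAlgebra.single (s i) 1) = _
  rw [lift_single, ← hφ i]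
  generalize s i = t
  generalize φ i = ψ
  induction t using FreeMagma.recOnMul with
  | ih1 x => rfl
  | ih2 s t hs ht =>
    rw [map_mul, map_mul, hs, ht, MonoidAlgebra.single_mul_single, one_mul]

/-- The spanning elements of the verbal subspace are multihomogeneous. Projection to multidegree (1,
…, 1) therefore either kills one or leaves it unchanged, and in the latter case it is an operadic
composition lying in the ideal. -/
theorem mem_carrier_of_mem_verbal {I : OperadIdeal k} {n : ℕ} {u : Mag k n}
    (hu : (u : Free k (Fin n)) ∈ verbal I (Fin n)) : u ∈ I.carrier n := by
  have key : ∀ f ∈ verbal I (Fin n),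
      homogeneousProj k (Finset.univ : Finset (Fin n)).val f ∈
        (I.carrier n).map (Submodule.subtype _) := by
    intro f hf
    unfold verbal at hf
    induction hf using Submodule.span_induction with
    | zero => simp
    | add a b _ _ ha hb => rw [map_add]; exact add_mem ha hb
    | smul c a _ ha => rw [map_smul]; exact Submodule.smul_mem _ _ ha
    | mem a ha =>
      obtain ⟨m, u, hu, v, rfl⟩ := ha
      have hmem := subst_mem (k := k) (y := fun i => MonoidAlgebra.single (v i) 1)
        (D := fun i => leaves (v i)) (fun i => Submodule.subset_span ⟨v i, rfl, rfl⟩) u.2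
      by_cases h : (Finset.univ : Finset (Fin m)).val.bind (fun i => leaves (v i)) =
          (Finset.univ : Finset (Fin n)).val
      · obtain ⟨w, hw, hw'⟩ := subst_mem_carrier hu v h
        rw [h] at hmem
        rw [homogeneousProj_of_mem hmem]
        exact ⟨w, hw, hw'⟩
      · rw [homogeneousProj_of_mem_ne hmem h]
        exact zero_mem _
  obtain ⟨w, hw, hw'⟩ := key _ hu
  rw [homogeneousProj_of_mem u.2] at hw'
  rwa [← Subtype.ext hw']

/-- An algebra over the operad `Q_{γ,δ}`. -/
structure IsQAlgebra (γ δ : k) (B : Type*) [NonUnitalNonAssocRing B] [Module k B] : Prop where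
  right_symm : ∀ a b c : B, associator a b c = associator a c b
  left_comm : ∀ a b c : B, a * (b * c) = b * (a * c)
  extra : ∀ a b c : B,
    γ • ((associator a b c + associator b a c) - (associator c a b + associator c b a)) +
      δ • ((a * (b * c) + b * (a * c)) - (a * (c * b) + b * (c * a))) = 0

/-! ### Evaluation in algebras over the operad -/

section Model

variable {B : Type*} [NonUnitalNonAssocRing B] [Module k B] [IsScalarTower k B B]
  [SMulCommClass k B B]

theorem IsQAlgebra.idealQ_le {γ δ : k} (h : IsQAlgebra γ δ B) (n : ℕ) :
    (idealQ γ δ).carrier n ≤ (identityIdeal k B).carrier n := by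
  refine idealSpan_le ?_ n
  rintro r ((rfl | rfl) | rfl) <;> intro b
  · simp only [rightSymmetry, associator_apply, map_sub, map_mul,
      FreeNonUnitalNonAssocAlgebra.lift_of_apply]
    exact sub_eq_zero.2 (h.right_symm _ _ _)
  · simp only [leftCommutativity, map_sub, map_mul, FreeNonUnitalNonAssocAlgebra.lift_of_apply]
    exact sub_eq_zero.2 (h.left_comm _ _ _)
  · simp only [extraIdentity, associator_apply, map_sub, map_add, map_smul, map_mul,
      FreeNonUnitalNonAssocAlgebra.lift_of_apply]
    exact h.extra _ _ _

/-- The evaluation of the operad `Q_{γ,δ}` at elements of an algebra over it. -/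
def evalQ {γ δ : k} (h : IsQAlgebra γ δ B) {n : ℕ} (b : Fin n → B) : Q γ δ n →ₗ[k] B :=
  ((idealQ γ δ).carrier n).liftQ
    { toFun := fun u => FreeNonUnitalNonAssocAlgebra.lift k b (u : Free k (Fin n))
      map_add' := fun u v => by rw [Submodule.coe_add, map_add]
      map_smul' := fun c u => by rw [Submodule.coe_smul, map_smul]; rfl }
    (fun _ hu => h.idealQ_le n hu b)

/-- The class of a multilinear monomial. -/
def treeClass (γ δ : k) {n : ℕ} (t : FreeMagma (Fin n))
    (ht : leaves t = (Finset.univ : Finset (Fin n)).val) : Q γ δ n :=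
  Submodule.Quotient.mk ⟨MonoidAlgebra.single t 1, Submodule.subset_span ⟨t, ht, rfl⟩⟩

theorem evalQ_treeClass {γ δ : k} (h : IsQAlgebra γ δ B) {n : ℕ} (b : Fin n → B)
    (t : FreeMagma (Fin n)) (ht : leaves t = (Finset.univ : Finset (Fin n)).val) :
    evalQ h b (treeClass γ δ t ht) = FreeMagma.lift b t :=
  lift_single b t

end Model

section RelFree

variable {I : OperadIdeal k} {X : Type}

theorem mem_span_monomials (a : RelFree I X) :
    a ∈ Submodule.span k (Set.range (FreeMagma.lift (gen I X))) := by
  obtain ⟨f, rfl⟩ := toRelFree_surjective a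
  induction f using MonoidAlgebra.induction_linear with
  | zero => simp
  | add f g hf hg => rw [map_add]; exact add_mem hf hg
  | single t r =>
    have hr : (MonoidAlgebra.single t r : Free k X) = r • MonoidAlgebra.single t 1 := by
      rw [MonoidAlgebra.smul_single, smul_eq_mul, mul_one]
    rw [hr, map_smul, toRelFree_single]
    exact Submodule.smul_mem _ _ (Submodule.subset_span ⟨t, rfl⟩)

/-- By construction only values on monomials vanish; trilinearity extends this to all arguments.
Trilinearity is assumed here because it is immediate for each explicit identity. -/
theorem lift_relFree_eq_zero {u : Mag k 3} (hu : u ∈ I.carrier 3)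
    (h_add₀ : ∀ a a' b c, FreeNonUnitalNonAssocAlgebra.lift k
      (![a + a', b, c] : Fin 3 → RelFree I X) (u : Free k (Fin 3)) =
        FreeNonUnitalNonAssocAlgebra.lift k ![a, b, c] (u : Free k (Fin 3)) +
        FreeNonUnitalNonAssocAlgebra.lift k ![a', b, c] (u : Free k (Fin 3)))
    (h_add₁ : ∀ a b b' c, FreeNonUnitalNonAssocAlgebra.lift k
      (![a, b + b', c] : Fin 3 → RelFree I X) (u : Free k (Fin 3)) =
        FreeNonUnitalNonAssocAlgebra.lift k ![a, b, c] (u : Free k (Fin 3)) +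
        FreeNonUnitalNonAssocAlgebra.lift k ![a, b', c] (u : Free k (Fin 3)))
    (h_add₂ : ∀ a b c c', FreeNonUnitalNonAssocAlgebra.lift k
      (![a, b, c + c'] : Fin 3 → RelFree I X) (u : Free k (Fin 3)) =
        FreeNonUnitalNonAssocAlgebra.lift k ![a, b, c] (u : Free k (Fin 3)) +
        FreeNonUnitalNonAssocAlgebra.lift k ![a, b, c'] (u : Free k (Fin 3)))
    (h_smul₀ : ∀ (r : k) a b c, FreeNonUnitalNonAssocAlgebra.lift k
      (![r • a, b, c] : Fin 3 → RelFree I X) (u : Free k (Fin 3)) =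
        r • FreeNonUnitalNonAssocAlgebra.lift k ![a, b, c] (u : Free k (Fin 3)))
    (h_smul₁ : ∀ (r : k) a b c, FreeNonUnitalNonAssocAlgebra.lift k
      (![a, r • b, c] : Fin 3 → RelFree I X) (u : Free k (Fin 3)) =
        r • FreeNonUnitalNonAssocAlgebra.lift k ![a, b, c] (u : Free k (Fin 3)))
    (h_smul₂ : ∀ (r : k) a b c, FreeNonUnitalNonAssocAlgebra.lift k
      (![a, b, r • c] : Fin 3 → RelFree I X) (u : Free k (Fin 3)) =
        r • FreeNonUnitalNonAssocAlgebra.lift k ![a, b, c] (u : Free k (Fin 3)))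
    (a b c : RelFree I X) :
    FreeNonUnitalNonAssocAlgebra.lift k ![a, b, c] (u : Free k (Fin 3)) = 0 := by
  -- Vanishing at a zero argument is homogeneity with scalar 0.
  have zero_of_smul : ∀ {y : RelFree I X}, y = (0 : k) • y → y = 0 := fun h => by
    rw [h, zero_smul]
  induction mem_span_monomials a using Submodule.span_induction with
  | zero => exact zero_of_smul (by rw [← h_smul₀, zero_smul])
  | add a a' _ _ h h' => rw [h_add₀, h, h', add_zero]
  | smul r a _ h => rw [h_smul₀, h, smul_zero]
  | mem a ha =>
    obtain ⟨s₀, rfl⟩ := ha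
    induction mem_span_monomials b using Submodule.span_induction with
    | zero => exact zero_of_smul (by rw [← h_smul₁, zero_smul])
    | add a a' _ _ h h' => rw [h_add₁, h, h', add_zero]
    | smul r a _ h => rw [h_smul₁, h, smul_zero]
    | mem b hb =>
      obtain ⟨s₁, rfl⟩ := hb
      induction mem_span_monomials c using Submodule.span_induction with
      | zero => exact zero_of_smul (by rw [← h_smul₂, zero_smul])
      | add a a' _ _ h h' => rw [h_add₂, h, h', add_zero]
      | smul r a _ h => rw [h_smul₂, h, smul_zero]
      | mem c hc =>
        obtain ⟨s₂, rfl⟩ := hc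
        have hv : subst (fun i => MonoidAlgebra.single (![s₀, s₁, s₂] i) 1)
            (u : Free k (Fin 3)) ∈ verbal I X :=
          Submodule.subset_span ⟨3, u, hu, ![s₀, s₁, s₂], rfl⟩
        rw [← toRelFree_eq_zero] at hv
        rw [← hv]
        let π : Free k X →ₙₐ[k] RelFree I X :=
          { toRelFree I X with
            map_zero' := map_zero (toRelFree I X)
            map_mul' := toRelFree_mul }
        have hπ : π.comp (FreeNonUnitalNonAssocAlgebra.lift k
            (fun i => MonoidAlgebra.single (![s₀, s₁, s₂] i) 1)) =
            FreeNonUnitalNonAssocAlgebra.lift k ![FreeMagma.lift (gen I X) s₀,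
              FreeMagma.lift (gen I X) s₁, FreeMagma.lift (gen I X) s₂] := by
          refine FreeNonUnitalNonAssocAlgebra.hom_ext k fun i => ?_
          rw [NonUnitalAlgHom.comp_apply, FreeNonUnitalNonAssocAlgebra.lift_of_apply,
            FreeNonUnitalNonAssocAlgebra.lift_of_apply]
          refine (toRelFree_single _).trans ?_
          fin_cases i <;> rfl
        exact (DFunLike.congr_fun hπ (u : Free k (Fin 3))).symm

theorem relFree_isQAlgebra (γ δ : k) (X : Type) : IsQAlgebra γ δ (RelFree (idealQ γ δ) X) where
  right_symm a b c := by
    have h := lift_relFree_eq_zero (X := X) (I := idealQ γ δ) (u := rightSymmetry k)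
      (mem_idealSpan (Or.inl (Or.inl rfl)))
    simp only [rightSymmetry, associator_apply, map_sub, map_mul,
      FreeNonUnitalNonAssocAlgebra.lift_of_apply, Matrix.cons_val, mul_add, add_mul,
      smul_mul_assoc, mul_smul_comm] at h
    exact sub_eq_zero.1 (h (by intros; abel) (by intros; abel) (by intros; abel)
      (by intros; module) (by intros; module) (by intros; module) a b c)
  left_comm a b c := by
    have h := lift_relFree_eq_zero (X := X) (I := idealQ γ δ) (u := leftCommutativity k)
      (mem_idealSpan (Or.inl (Or.inr rfl)))
    simp only [leftCommutativity, map_sub, map_mul,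
      FreeNonUnitalNonAssocAlgebra.lift_of_apply, Matrix.cons_val, mul_add, add_mul,
      smul_mul_assoc, mul_smul_comm] at h
    exact sub_eq_zero.1 (h (by intros; abel) (by intros; abel) (by intros; abel)
      (by intros; module) (by intros; module) (by intros; module) a b c)
  extra a b c := by
    have h := lift_relFree_eq_zero (X := X) (I := idealQ γ δ) (u := extraIdentity γ δ)
      (mem_idealSpan (Or.inr rfl))
    simp only [extraIdentity, associator_apply, map_sub, map_add, map_smul, map_mul,
      FreeNonUnitalNonAssocAlgebra.lift_of_apply, Matrix.cons_val, mul_add, add_mul,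
      smul_mul_assoc, mul_smul_comm] at h
    exact h (by intros; module) (by intros; module) (by intros; module)
      (by intros; module) (by intros; module) (by intros; module) a b c

end RelFree

section Dimension

variable {γ δ : k} {n : ℕ}

/-- The kernel of the map from multilinear elements to the relatively free algebra lies in the
ideal, so the operad component is a quotient of the image, and the image lies in the span of `b`. -/
theorem finrank_Q_le {ι : Type} [Fintype ι] (b : ι → RelFree (idealQ γ δ) (Fin n))
    (h : ∀ t : FreeMagma (Fin n), leaves t = (Finset.univ : Finset (Fin n)).val →
      FreeMagma.lift (gen (idealQ γ δ) (Fin n)) t ∈ Submodule.span k (Set.range b)) :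
    Module.Finite k (Q γ δ n) ∧ Module.finrank k (Q γ δ n) ≤ Fintype.card ι := by
  let Φ : Mag k n →ₗ[k] RelFree (idealQ γ δ) (Fin n) :=
    (toRelFree (idealQ γ δ) (Fin n)).comp (Submodule.subtype _)
  have hker : Φ.ker ≤ (idealQ γ δ).carrier n := fun u hu =>
    mem_carrier_of_mem_verbal (toRelFree_eq_zero.1 hu)
  have hrange : Φ.range ≤ Submodule.span k (Set.range b) := by
    rintro _ ⟨⟨u, hu⟩, rfl⟩
    change toRelFree _ _ u ∈ _
    unfold homogeneous at hu
    induction hu using Submodule.span_induction with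
    | zero => simp
    | add a b _ _ ha hb => rw [map_add]; exact add_mem ha hb
    | smul c a _ ha => rw [map_smul]; exact Submodule.smul_mem _ _ ha
    | mem a ha =>
      obtain ⟨t, ht, rfl⟩ := ha
      rw [toRelFree_single]
      exact h t ht
  have hfin : FiniteDimensional k (Submodule.span k (Set.range b)) :=
    FiniteDimensional.span_of_finite k (Set.finite_range b)
  have hfin' : FiniteDimensional k Φ.range := Submodule.finiteDimensional_of_le hrange
  let Ψ : Φ.range →ₗ[k] Q γ δ n :=
    (Submodule.factor hker).comp Φ.quotKerEquivRange.symm.toLinearMap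
  have hΨ : Function.Surjective Ψ :=
    (Submodule.factor_surjective hker).comp Φ.quotKerEquivRange.symm.surjective
  refine ⟨Module.Finite.of_surjective Ψ hΨ, ?_⟩
  calc Module.finrank k (Q γ δ n) ≤ Module.finrank k Φ.range :=
        Ψ.finrank_le_finrank_of_surjective hΨ
    _ ≤ Module.finrank k (Submodule.span k (Set.range b)) := Submodule.finrank_mono hrange
    _ ≤ Fintype.card ι := finrank_range_le_card b

end Dimension

end OperadIdeals

/-! ### Expressions determined by their multidegree -/

section Iteration

variable {A : Type*} [Mul A] {X : Type}

/-- The product `g x₁ * (g x₂ * (⋯ * (g xₘ * a)))` over a multiset of labels. -/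
def leftIter (hl : ∀ a b c : A, a * (b * c) = b * (a * c)) (g : X → A) (d : Multiset X) (a : A) :
    A :=
  haveI : LeftCommutative fun (x : X) (a : A) => g x * a := ⟨fun x y a => hl (g x) (g y) a⟩
  d.foldr (fun x a => g x * a) a

/-- The product `(((a * g x₁) * g x₂) ⋯) * g xₘ` over a multiset of labels. -/
def rightIter (hr : ∀ a b c : A, a * b * c = a * c * b) (g : X → A) (d : Multiset X) (a : A) : A :=
  haveI : LeftCommutative fun (x : X) (a : A) => a * g x := ⟨fun x y a => hr a (g y) (g x)⟩
  d.foldr (fun x a => a * g x) a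

variable (hl : ∀ a b c : A, a * (b * c) = b * (a * c))
  (hr : ∀ a b c : A, a * b * c = a * c * b) (g : X → A)

theorem leftIter_zero (a : A) : leftIter hl g 0 a = a := rfl

theorem leftIter_cons (x : X) (d : Multiset X) (a : A) :
    leftIter hl g (x ::ₘ d) a = g x * leftIter hl g d a :=
  haveI : LeftCommutative fun (x : X) (a : A) => g x * a := ⟨fun x y a => hl (g x) (g y) a⟩
  Multiset.foldr_cons (fun x a => g x * a) a x d

theorem leftIter_add (d e : Multiset X) (a : A) :
    leftIter hl g (d + e) a = leftIter hl g d (leftIter hl g e a) :=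
  haveI : LeftCommutative fun (x : X) (a : A) => g x * a := ⟨fun x y a => hl (g x) (g y) a⟩
  Multiset.foldr_add (fun x a => g x * a) a d e

theorem rightIter_cons (x : X) (d : Multiset X) (a : A) :
    rightIter hr g (x ::ₘ d) a = rightIter hr g d a * g x :=
  haveI : LeftCommutative fun (x : X) (a : A) => a * g x := ⟨fun x y a => hr a (g y) (g x)⟩
  Multiset.foldr_cons (fun x a => a * g x) a x d

theorem leaves_mul (s t : FreeMagma X) : leaves (s * t) = leaves s + leaves t := rfl

theorem leaves_of (x : X) : leaves (FreeMagma.of x) = {x} := rfl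

theorem leaves_ne_zero (t : FreeMagma X) : leaves t ≠ 0 := by
  induction t using FreeMagma.recOnMul with
  | ih1 x => exact Multiset.singleton_ne_zero x
  | ih2 s t hs ht => exact fun h => hs (add_eq_zero.1 h).1

theorem exists_leaves_eq {d : Multiset X} (hd : d ≠ 0) : ∃ t : FreeMagma X, leaves t = d := by
  induction d using Multiset.induction with
  | empty => exact absurd rfl hd
  | cons x d ih =>
    by_cases h : d = 0
    · exact ⟨FreeMagma.of x, by rw [h]; rfl⟩
    · obtain ⟨t, ht⟩ := ih h
      exact ⟨FreeMagma.of x * t, by rw [leaves_mul, ht, leaves_of, Multiset.singleton_add]⟩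

variable {g}

/-- On values of G a product acts as its factors in succession: (zt)G(w) = wG(zt) = w(zG(t)) =
z(wG(t)) = z(tG(w)). -/
theorem lift_mul_eq_leftIter {G : A → A} (h_mul : ∀ z t, G (z * t) = z * G t)
    (h_comm : ∀ z t, z * G t = t * G z) (u : FreeMagma X) (w : A) :
    FreeMagma.lift g u * G w = leftIter hl g (leaves u) (G w) := by
  induction u using FreeMagma.recOnMul generalizing w with
  | ih1 x => rfl
  | ih2 z t hz ht =>
    rw [map_mul, leaves_mul, leftIter_add, ← ht, ← h_mul (FreeMagma.lift g t) w, ← hz,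
      h_comm _ w, h_mul, h_mul, hl, h_comm w]

/-- From G(ab) = aG(b) = bG(a) one may descend into whichever factor contains x, the other factor
acting through its leaves. Since x is an arbitrary leaf, the value depends only on the multidegree.
-/
theorem apply_lift_eq_leftIter {G : A → A} (h_mul : ∀ z t, G (z * t) = z * G t)
    (h_comm : ∀ z t, z * G t = t * G z) {t : FreeMagma X} {x : X} {d : Multiset X}
    (ht : leaves t = x ::ₘ d) : G (FreeMagma.lift g t) = leftIter hl g d (G (g x)) := by
  induction t using FreeMagma.recOnMul generalizing d with
  | ih1 y =>
    obtain ⟨rfl, rfl⟩ := (Multiset.singleton_eq_cons_iff _).1 ht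
    rfl
  | ih2 a b ha hb =>
    rw [leaves_mul] at ht
    have hx : x ∈ leaves a + leaves b := by rw [ht]; exact Multiset.mem_cons_self x d
    rw [map_mul, h_mul]
    rcases Multiset.mem_add.1 hx with h | h
    · obtain ⟨a', h⟩ := Multiset.exists_cons_of_mem h
      rw [h, Multiset.cons_add, Multiset.cons_inj_right] at ht
      rw [h_comm, lift_mul_eq_leftIter hl h_mul h_comm, ha h, ← leftIter_add, add_comm, ht]
    · obtain ⟨b', h⟩ := Multiset.exists_cons_of_mem h
      rw [h, Multiset.add_cons, Multiset.cons_inj_right] at ht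
      rw [lift_mul_eq_leftIter hl h_mul h_comm, hb h, ← leftIter_add, ht]

/-- Factors of the first argument can be moved into the second, F(zt, w) = F(z, tw) = F(t, zw),
until only the chosen leaf x remains. -/
theorem exists_apply₂_lift_eq {F : A → A → A} (h_symm : ∀ a b, F a b = F b a)
    (h_mul : ∀ z t w, F (z * t) w = z * F t w) (h_comm : ∀ z t w, z * F t w = w * F t z)
    {v : FreeMagma X} {x : X} (hx : x ∈ leaves v) (w : FreeMagma X) :
    ∃ w' : FreeMagma X, x ::ₘ leaves w' = leaves v + leaves w ∧
      F (FreeMagma.lift g v) (FreeMagma.lift g w) = F (g x) (FreeMagma.lift g w') := by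
  induction v using FreeMagma.recOnMul generalizing w with
  | ih1 y =>
    obtain rfl : x = y := by simpa [leaves] using hx
    exact ⟨w, by rw [leaves_of, Multiset.singleton_add], rfl⟩
  | ih2 z t hz ht =>
    rcases Multiset.mem_add.1 (show x ∈ leaves z + leaves t from hx) with h | h
    · obtain ⟨w', h₁, h₂⟩ := hz h (t * w)
      refine ⟨w', by rw [h₁, leaves_mul, leaves_mul, add_assoc], ?_⟩
      rw [← h₂, map_mul, map_mul, h_mul, h_symm (FreeMagma.lift g z), h_mul, h_symm _
        (FreeMagma.lift g z), h_symm (FreeMagma.lift g t), h_comm, h_symm]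
    · obtain ⟨w', h₁, h₂⟩ := ht h (z * w)
      refine ⟨w', by rw [h₁, leaves_mul, leaves_mul, add_assoc, add_left_comm], ?_⟩
      rw [← h₂, map_mul, map_mul, h_mul, h_symm (FreeMagma.lift g t), h_symm (FreeMagma.lift g t),
        h_mul]

theorem apply₂_lift_eq_leftIter {F : A → A → A} (h_symm : ∀ a b, F a b = F b a)
    (h_mul : ∀ z t w, F (z * t) w = z * F t w) (h_comm : ∀ z t w, z * F t w = w * F t z)
    {v w : FreeMagma X} {x y : X} {d : Multiset X}
    (h : leaves v + leaves w = x ::ₘ y ::ₘ d) :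
    F (FreeMagma.lift g v) (FreeMagma.lift g w) = leftIter hl g d (F (g x) (g y)) := by
  have key : ∀ {v w : FreeMagma X}, leaves v + leaves w = x ::ₘ y ::ₘ d → x ∈ leaves v →
      F (FreeMagma.lift g v) (FreeMagma.lift g w) = leftIter hl g d (F (g x) (g y)) := by
    intro v w h hx
    obtain ⟨w', h₁, h₂⟩ := exists_apply₂_lift_eq (g := g) h_symm h_mul h_comm hx w
    rw [h, Multiset.cons_inj_right] at h₁
    rw [h₂]
    refine apply_lift_eq_leftIter hl (G := F (g x)) (fun z t => ?_) (fun z t => h_comm z _ t) h₁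
    rw [h_symm, h_mul, h_symm]
  have hx : x ∈ leaves v + leaves w := by rw [h]; exact Multiset.mem_cons_self _ _
  rcases Multiset.mem_add.1 hx with hx | hx
  · exact key h hx
  · rw [h_symm]
    exact key (by rw [add_comm, h]) hx

/-- The one-argument reduction is applied to each slot in turn. It serves for the associator when
(γ,δ) = (1,0) and for a(bc) when (γ,δ) = (0,1). -/
theorem apply₃_lift_eq_leftIter {T : A → A → A → A} (h_symm₁ : ∀ a b c, T a b c = T b a c)
    (h_symm₂ : ∀ a b c, T a b c = T a c b) (h_mul : ∀ z t v w, T (z * t) v w = z * T t v w)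
    (h_comm : ∀ z t v w, z * T t v w = t * T z v w)
    {u v w : FreeMagma X} {x y z : X} {d : Multiset X}
    (h : leaves u + leaves v + leaves w = x ::ₘ y ::ₘ z ::ₘ d) :
    T (FreeMagma.lift g u) (FreeMagma.lift g v) (FreeMagma.lift g w) =
      leftIter hl g d (T (g x) (g y) (g z)) := by
  have step : ∀ {u : FreeMagma X}, x ∈ leaves u → ∀ v w : FreeMagma X, ∃ v' : FreeMagma X,
      x ::ₘ leaves v' = leaves u + leaves v ∧
      T (FreeMagma.lift g u) (FreeMagma.lift g v) (FreeMagma.lift g w) =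
        T (g x) (FreeMagma.lift g v') (FreeMagma.lift g w) := by
    intro u hx v w
    exact exists_apply₂_lift_eq (F := fun a b => T a b (FreeMagma.lift g w))
      (fun a b => h_symm₁ a b _) (fun z t b => h_mul z t b _)
      (fun z t b => by rw [h_symm₁, h_comm, h_symm₁]) hx v
  have key : ∀ {u v w : FreeMagma X}, leaves u + leaves v + leaves w = x ::ₘ y ::ₘ z ::ₘ d →
      x ∈ leaves u → T (FreeMagma.lift g u) (FreeMagma.lift g v) (FreeMagma.lift g w) =
      leftIter hl g d (T (g x) (g y) (g z)) := by
    intro u v w h hx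
    obtain ⟨v', h₁, h₂⟩ := step hx v w
    rw [← h₁, Multiset.cons_add, Multiset.cons_inj_right] at h
    rw [h₂]
    refine apply₂_lift_eq_leftIter hl (F := T (g x)) (fun a b => h_symm₂ _ a b)
      (fun z t w => ?_) (fun z t w => ?_) h
    · rw [h_symm₁, h_mul, h_symm₁]
    · rw [h_symm₂, h_symm₁, h_comm, h_symm₁, h_symm₂]
  have hx : x ∈ leaves u + leaves v + leaves w := by rw [h]; exact Multiset.mem_cons_self _ _
  rcases Multiset.mem_add.1 hx with hx | hx
  · rcases Multiset.mem_add.1 hx with hx | hx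
    · exact key h hx
    · rw [h_symm₁]
      exact key (by rw [add_comm (leaves v), h]) hx
  · rw [h_symm₂, h_symm₁]
    exact key (by rw [← h]; abel) hx

end Iteration

/-! ### The extra identity as total symmetry -/

section Symmetry

/-- For fixed a, b, c only three values p, q, r of f occur, according to the first argument. The
hypothesis gives p + r = 2q and q + r = 2p, whence 3(p - q) = 0. -/
theorem symm_of_add_eq (k : Type*) [Field k] [CharZero k] {A : Type*} [AddCommGroup A]
    [Module k A] {f : A → A → A → A} (h : ∀ a b c, f a b c = f a c b)
    (h' : ∀ a b c, f a b c + f b a c = f c a b + f c b a) (a b c : A) : f a b c = f b a c := by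
  have h₁ := h' a c b
  have h₂ := h' b c a
  rw [h c a b, h a c b, h b c a, ← two_smul k (f b a c)] at h₁
  rw [h b c a, h c b a, h a c b, h c a b, ← two_smul k (f a b c)] at h₂
  have h₃ : (3 : k) • (f a b c - f b a c) = 0 := by
    have e : (3 : k) • (f a b c - f b a c) = (f a b c + f c b a - (2 : k) • f b a c) -
        (f b a c + f c b a - (2 : k) • f a b c) := by module
    rw [e, h₁, h₂, sub_self, sub_self, sub_self]
  exact sub_eq_zero.1 ((smul_eq_zero.1 h₃).resolve_left three_ne_zero)

variable {k : Type*} [Field k] [CharZero k] {A : Type*} [NonUnitalNonAssocRing A] [Module k A]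

variable {γ δ : k}

theorem IsQAlgebra.symm (hA : IsQAlgebra γ δ A) (a b c : A) :
    γ • associator a b c - δ • (b * (c * a)) = γ • associator b a c - δ • (a * (c * b)) := by
  refine symm_of_add_eq k (f := fun a b c : A => γ • associator a b c - δ • (b * (c * a)))
    (fun a b c => ?_) (fun a b c => ?_) a b c
  · simp only [hA.right_symm a b c, hA.left_comm b c a]
  · have h := hA.extra a b c
    rw [← sub_eq_zero, ← h, hA.left_comm a b c, hA.left_comm a c b, hA.left_comm b c a]
    module

end Symmetry

/-! ### Spanning by right combs and associators -/

section Spanning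

variable {k : Type*} [Field k] {A : Type*} [NonUnitalNonAssocRing A] [Module k A]
  [SMulCommClass k A A] {X : Type}

theorem leftIter_add_right (hl : ∀ a b c : A, a * (b * c) = b * (a * c)) (g : X → A)
    (d : Multiset X) (a b : A) :
    leftIter hl g d (a + b) = leftIter hl g d a + leftIter hl g d b := by
  induction d using Multiset.induction with
  | empty => rfl
  | cons x d ih => simp only [leftIter_cons, ih, mul_add]

theorem associator_mul_right (hl : ∀ a b c : A, a * (b * c) = b * (a * c)) (a b c d : A) :
    associator a b (c * d) = c * associator a b d := by
  simp only [associator_apply, mul_sub]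
  rw [hl (a * b) c d, hl b c d, hl a c (b * d)]

/-- The values of the monomials `x₁ (x₂ (⋯ (xₘ x)))` of multidegree `d`, together with the values
of all associators `(x, v, w)` of multidegree `d` with a variable `x`. -/
def combsAndAssociators (hl : ∀ a b c : A, a * (b * c) = b * (a * c)) (g : X → A)
    (d : Multiset X) : Set A :=
  {a | (∃ x e, x ::ₘ e = d ∧ a = leftIter hl g e (g x)) ∨
    ∃ (x : X) (v w : FreeMagma X), x ::ₘ (leaves v + leaves w) = d ∧
      a = associator (g x) (FreeMagma.lift g v) (FreeMagma.lift g w)}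

variable (k) in
-- Rewriting (u₁u₂)v as u₁(u₂v) + (u₁,u₂,v) reduces left factors to variables. A variable y
-- lengthens a comb, and y(x,v,w) = (x,yv,w) is again an associator with a variable in front.
theorem lift_mem_span_combsAndAssociators (hl : ∀ a b c : A, a * (b * c) = b * (a * c))
    (g : X → A) (h_mul : ∀ a b c d : A, associator a (b * c) d = b * associator a c d)
    (h_assoc : ∀ u v w : FreeMagma X,
      associator (FreeMagma.lift g u) (FreeMagma.lift g v) (FreeMagma.lift g w) ∈
        Submodule.span k (combsAndAssociators hl g (leaves u + leaves v + leaves w)))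
    (t : FreeMagma X) :
    FreeMagma.lift g t ∈ Submodule.span k (combsAndAssociators hl g (leaves t)) := by
  have key : ∀ u v : FreeMagma X,
      FreeMagma.lift g v ∈ Submodule.span k (combsAndAssociators hl g (leaves v)) →
      FreeMagma.lift g (u * v) ∈
        Submodule.span k (combsAndAssociators hl g (leaves u + leaves v)) := by
    intro u
    induction u using FreeMagma.recOnMul with
    | ih1 y =>
      intro v hv
      rw [map_mul]
      generalize leaves v = d at hv
      generalize FreeMagma.lift g v = a at hv
      induction hv using Submodule.span_induction with
      | zero => rw [mul_zero]; exact zero_mem _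
      | add a b _ _ ha hb => rw [mul_add]; exact add_mem ha hb
      | smul c a _ ha => rw [mul_smul_comm]; exact Submodule.smul_mem _ _ ha
      | mem a ha =>
        refine Submodule.subset_span ?_
        rcases ha with ⟨x, e, rfl, rfl⟩ | ⟨x, v, w, rfl, rfl⟩
        · refine Or.inl ⟨x, y ::ₘ e, ?_, (leftIter_cons hl g y e _).symm⟩
          rw [leaves_of, Multiset.singleton_add, Multiset.cons_swap]
        · refine Or.inr ⟨x, FreeMagma.of y * v, w, ?_, ?_⟩
          · rw [leaves_mul, leaves_of, Multiset.singleton_add, Multiset.singleton_add,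
              Multiset.cons_add, Multiset.cons_swap]
          · rw [map_mul, h_mul]
    | ih2 u₁ u₂ h₁ h₂ =>
      intro v hv
      have e : FreeMagma.lift g (u₁ * u₂ * v) = FreeMagma.lift g (u₁ * (u₂ * v)) +
          associator (FreeMagma.lift g u₁) (FreeMagma.lift g u₂) (FreeMagma.lift g v) := by
        simp only [map_mul, associator_apply]
        abel
      rw [e]
      refine add_mem ?_ (h_assoc u₁ u₂ v)
      rw [leaves_mul, add_assoc]
      exact h₁ (u₂ * v) (h₂ v hv)
  induction t using FreeMagma.recOnMul with
  | ih1 x => exact Submodule.subset_span (Or.inl ⟨x, 0, rfl, rfl⟩)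
  | ih2 u v hu hv => exact key u v hv

end Spanning

/-! ### Consequences of total symmetry in the three cases -/

section TotallySymmetric

variable {k : Type*} [Field k] [CharZero k] {A : Type*} [NonUnitalNonAssocRing A] [Module k A]

theorem IsQAlgebra.associator_symm (hA : IsQAlgebra (1 : k) 0 A) (a b c : A) :
    associator a b c = associator b a c := by
  simpa using hA.symm a b c

theorem IsQAlgebra.associator_mul_left (hA : IsQAlgebra (1 : k) 0 A) (a b c d : A) :
    associator (a * b) c d = a * associator b c d := by
  rw [hA.associator_symm, hA.right_symm, associator_mul_right hA.left_comm, hA.right_symm,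
    hA.associator_symm]

theorem IsQAlgebra.mul_associator_comm (hA : IsQAlgebra (1 : k) 0 A) (a b c d : A) :
    a * associator b c d = b * associator a c d := by
  -- The Teichmüller identity after cancellation. Its left side is symmetric in b, c and its right
  -- side is antisymmetric, so both vanish in characteristic other than 2.
  have teich : ∀ a b c d : A,
      associator a b c * d = c * associator a b d - b * associator a c d := by
    intro a b c d
    have h := associator_cocycle a b c d
    rw [hA.associator_mul_left, associator_mul_right hA.left_comm, hA.associator_symm a (b * c),
      hA.associator_mul_left, hA.associator_symm c] at h
    rw [← sub_eq_zero, ← h]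
    abel
  have h : ∀ a b c : A, c * associator a b d = b * associator a c d := by
    intro a b c
    have h₁ := teich a b c d
    have h₂ := teich a c b d
    rw [hA.right_symm a c b, h₁] at h₂
    have h₃ : (2 : k) • (c * associator a b d - b * associator a c d) = 0 := by
      rw [two_smul]
      nth_rewrite 2 [h₂]
      abel
    exact sub_eq_zero.1 ((smul_eq_zero.1 h₃).resolve_left two_ne_zero)
  rw [hA.associator_symm b, h, hA.associator_symm a]

theorem IsQAlgebra.mul_mul_symm (hA : IsQAlgebra (0 : k) 1 A) (a b c : A) :
    a * (b * c) = c * (b * a) := by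
  simpa using hA.symm c a b

theorem IsQAlgebra.mul_mul_comm' (hA : IsQAlgebra (0 : k) 1 A) (a b c : A) :
    a * (b * c) = a * (c * b) := by
  rw [hA.left_comm, hA.mul_mul_symm, hA.left_comm]

theorem IsQAlgebra.right_comm (hA : IsQAlgebra (0 : k) 1 A) (a b c : A) :
    a * b * c = a * c * b := by
  have h := hA.right_symm a b c
  rwa [associator_apply, associator_apply, hA.mul_mul_comm' a b c, sub_left_inj] at h

/-- With right factor cd, the left side is a value of the symmetric operation u(vw), so ab can be
moved inside and its factors pulled out by left commutativity. -/
theorem IsQAlgebra.mul_mul_mul (hA : IsQAlgebra (0 : k) 1 A) (a b c d : A) :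
    a * b * (c * d) = a * (b * (c * d)) := by
  rw [hA.mul_mul_symm (a * b), hA.left_comm c, hA.left_comm d, hA.mul_mul_symm d]

theorem IsQAlgebra.associator_add (hA : IsQAlgebra (1 : k) (-1) A) (a b c : A) :
    associator a b c + b * (c * a) = associator b a c + a * (c * b) := by
  simpa using hA.symm a b c

/-- Compare the symmetry of (a,b,c) + b(ca) with its third argument replaced by cd against c times
the symmetry for a, b, d: the terms b((cd)a) and a((cd)b) contribute exactly the two associators. -/
theorem IsQAlgebra.mul_associator_symm (hA : IsQAlgebra (1 : k) (-1) A) (a b c d : A) :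
    b * associator c d a = a * associator c d b := by
  have h₁ := hA.associator_add a b (c * d)
  have h₂ := congrArg (c * ·) (hA.associator_add a b d)
  have e₁ : b * (c * d * a) = b * associator c d a + c * (b * (d * a)) := by
    rw [hA.left_comm c b, associator_apply, mul_sub]; abel
  have e₂ : a * (c * d * b) = a * associator c d b + c * (a * (d * b)) := by
    rw [hA.left_comm c a, associator_apply, mul_sub]; abel
  rw [associator_mul_right hA.left_comm, associator_mul_right hA.left_comm, e₁, e₂] at h₁
  simp only [mul_add] at h₂
  rw [← add_right_inj (c * associator a b d + c * (b * (d * a)))]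
  nth_rewrite 2 [h₂]
  calc _ = c * associator a b d + (b * associator c d a + c * (b * (d * a))) := by abel
    _ = _ := h₁
    _ = _ := by abel

/-- Compare the symmetry for ab, c, d with a times the symmetry for b, c, d; the surplus comes from
(ab)(dc), which differs from a(b(dc)) by d(a,b,c) = b(a,c,d). -/
theorem IsQAlgebra.associator_derivation (hA : IsQAlgebra (1 : k) (-1) A) (a b c d : A) :
    associator (a * b) c d = a * associator b c d + b * associator a c d := by
  have h₁ := hA.associator_add (a * b) c d
  have h₂ := congrArg (a * ·) (hA.associator_add b c d)
  have e₁ : a * b * (d * c) = d * associator a b c + a * (b * (d * c)) := by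
    rw [hA.left_comm b d, hA.left_comm a d, associator_apply, mul_sub, hA.left_comm _ d]; abel
  have e₂ : c * (d * (a * b)) = a * (c * (d * b)) := by rw [hA.left_comm d, hA.left_comm c]
  rw [hA.right_symm c, associator_mul_right hA.left_comm, hA.right_symm c, e₁, e₂,
    hA.right_symm a b, hA.mul_associator_symm b d a c] at h₁
  simp only [mul_add] at h₂
  rw [← add_left_inj (a * (c * (d * b))), h₁]
  calc _ = (a * associator c b d + a * (b * (d * c))) + b * associator a c d := by abel
    _ = _ := by rw [← h₂]; abel

end TotallySymmetric

/-! ### Upper bounds: n + 1 spanning elements -/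

section UpperBound

theorem exists_univ_eq_cons₃ {n : ℕ} (hn : 3 ≤ n) (x : Fin n) :
    ∃ y z d, (Finset.univ : Finset (Fin n)).val = x ::ₘ y ::ₘ z ::ₘ d := by
  obtain ⟨s, hs⟩ := Multiset.exists_cons_of_mem (Finset.mem_univ_val x)
  have hcard : Multiset.card s + 1 = n := by
    rw [← Multiset.card_cons, ← hs]; exact Finset.card_fin n
  obtain ⟨y, hy⟩ := Multiset.card_pos_iff_exists_mem.1 (show 0 < Multiset.card s by omega)
  obtain ⟨s', rfl⟩ := Multiset.exists_cons_of_mem hy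
  rw [Multiset.card_cons] at hcard
  obtain ⟨z, hz⟩ := Multiset.card_pos_iff_exists_mem.1 (show 0 < Multiset.card s' by omega)
  obtain ⟨d, rfl⟩ := Multiset.exists_cons_of_mem hz
  exact ⟨y, z, d, hs⟩

theorem exists_univ_eq_cons₃_of_ne {n : ℕ} (hn : 3 ≤ n) {x y : Fin n} (hxy : x ≠ y) :
    ∃ z d, (Finset.univ : Finset (Fin n)).val = x ::ₘ y ::ₘ z ::ₘ d := by
  obtain ⟨s, hs⟩ := Multiset.exists_cons_of_mem (Finset.mem_univ_val x)
  have hcard : Multiset.card s + 1 = n := by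
    rw [← Multiset.card_cons, ← hs]; exact Finset.card_fin n
  have hy : y ∈ x ::ₘ s := by rw [← hs]; exact Finset.mem_univ y
  obtain ⟨s', rfl⟩ := Multiset.exists_cons_of_mem
    ((Multiset.mem_cons.1 hy).resolve_left hxy.symm)
  rw [Multiset.card_cons] at hcard
  obtain ⟨z, hz⟩ := Multiset.card_pos_iff_exists_mem.1 (show 0 < Multiset.card s' by omega)
  obtain ⟨d, rfl⟩ := Multiset.exists_cons_of_mem hz
  exact ⟨z, d, hs⟩

variable {k : Type*} [Field k] [CharZero k] {n : ℕ}

theorem finrank_Q_one_zero_le (hn : 3 ≤ n) :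
    Module.Finite k (Q (1 : k) 0 n) ∧ Module.finrank k (Q (1 : k) 0 n) ≤ n + 1 := by
  have hA := relFree_isQAlgebra (1 : k) 0 (Fin n)
  obtain ⟨y, z, d, hd⟩ := exists_univ_eq_cons₃ hn ⟨0, by omega⟩
  choose e he using fun x : Fin n => Multiset.exists_cons_of_mem (Finset.mem_univ_val x)
  generalize (⟨0, by omega⟩ : Fin n) = x at hd
  let g := gen (idealQ (1 : k) 0) (Fin n)
  let b : Option (Fin n) → RelFree (idealQ (1 : k) 0) (Fin n) := fun o =>
    o.elim (leftIter hA.left_comm g d (associator (g x) (g y) (g z)))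
      fun x => leftIter hA.left_comm g (e x) (g x)
  have h := finrank_Q_le b fun t ht => ?_
  · simpa using h
  have hmem := lift_mem_span_combsAndAssociators k hA.left_comm g
    (fun a b c d => by rw [hA.right_symm, associator_mul_right hA.left_comm, hA.right_symm])
    (fun u => ?_) t
  · refine Submodule.span_mono ?_ hmem
    rw [ht]
    rintro a (⟨x', e', h', rfl⟩ | ⟨x', v, w, h', rfl⟩)
    · refine ⟨some x', ?_⟩
      rw [he x', Multiset.cons_inj_right] at h'
      rw [h']
      rfl
    · refine ⟨none, ?_⟩
      exact (apply₃_lift_eq_leftIter hA.left_comm hA.associator_symm hA.right_symm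
        hA.associator_mul_left hA.mul_associator_comm (u := FreeMagma.of x')
        (by rw [← hd, ← h', leaves_of, add_assoc, Multiset.singleton_add])).symm
  -- A composite first argument is reduced to one of its leaves by moving its other factors into the
  -- second argument.
  · intro v w
    obtain ⟨x', hx'⟩ := Multiset.exists_mem_of_ne_zero (leaves_ne_zero u)
    obtain ⟨v', h₁, h₂⟩ := exists_apply₂_lift_eq (g := g)
      (F := fun a b => associator a b (FreeMagma.lift g w))
      (fun a b => hA.associator_symm a b _) (fun z t b => hA.associator_mul_left z t b _)
      (fun z t b => by
        rw [hA.associator_symm, hA.mul_associator_comm, hA.associator_symm]) hx' v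
    exact Submodule.subset_span (Or.inr ⟨x', v', w, by rw [← h₁, Multiset.cons_add], h₂⟩)

theorem finrank_Q_zero_one_le (hn : 3 ≤ n) :
    Module.Finite k (Q (0 : k) 1 n) ∧ Module.finrank k (Q (0 : k) 1 n) ≤ n + 1 := by
  have hA := relFree_isQAlgebra (0 : k) 1 (Fin n)
  obtain ⟨y, z, d, hd⟩ := exists_univ_eq_cons₃ hn ⟨0, by omega⟩
  choose e he using fun x : Fin n => Multiset.exists_cons_of_mem (Finset.mem_univ_val x)
  generalize (⟨0, by omega⟩ : Fin n) = x at hd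
  let g := gen (idealQ (0 : k) 1) (Fin n)
  let b : Option (Fin n) → RelFree (idealQ (0 : k) 1) (Fin n) := fun o =>
    o.elim (leftIter hA.left_comm g d (g x * (g y * g z)))
      fun x => rightIter hA.right_comm g (e x) (g x)
  have h := finrank_Q_le b fun t ht => ?_
  · simpa using h
  -- A left comb times a variable is a left comb, and right commutativity turns (u(vw))y into
  -- (uy)(vw); any other product already has the form u(vw).
  have key : ∀ t : FreeMagma (Fin n),
      (∃ x e, x ::ₘ e = leaves t ∧ FreeMagma.lift g t = rightIter hA.right_comm g e (g x)) ∨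
      ∃ u v w : FreeMagma (Fin n), leaves u + leaves v + leaves w = leaves t ∧
        FreeMagma.lift g t =
          FreeMagma.lift g u * (FreeMagma.lift g v * FreeMagma.lift g w) := by
    intro t
    induction t using FreeMagma.recOnMul with
    | ih1 x => exact Or.inl ⟨x, 0, rfl, rfl⟩
    | ih2 u v hu _ =>
      induction v using FreeMagma.recOnMul with
      | ih2 v w _ _ => exact Or.inr ⟨u, v, w, by simp only [leaves_mul, add_assoc], rfl⟩
      | ih1 y =>
        rcases hu with ⟨x, e, h₁, h₂⟩ | ⟨u', v, w, h₁, h₂⟩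
        · refine Or.inl ⟨x, y ::ₘ e, ?_, ?_⟩
          · rw [leaves_mul, ← h₁, leaves_of, add_comm, Multiset.singleton_add,
              Multiset.cons_swap]
          · rw [map_mul, h₂, rightIter_cons]; rfl
        · refine Or.inr ⟨u' * FreeMagma.of y, v, w, ?_, ?_⟩
          · rw [leaves_mul, leaves_mul, ← h₁]; abel
          · rw [map_mul, h₂, map_mul, hA.right_comm]
  refine Submodule.subset_span ?_
  rcases key t with ⟨x', e', h', h''⟩ | ⟨u, v, w, h', h''⟩
  · refine ⟨some x', ?_⟩
    rw [ht, he x', Multiset.cons_inj_right] at h'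
    rw [h'', h']
    rfl
  · refine ⟨none, ?_⟩
    rw [h'']
    exact (apply₃_lift_eq_leftIter (T := fun a b c => a * (b * c)) hA.left_comm hA.left_comm
      hA.mul_mul_comm' hA.mul_mul_mul (fun z t v w => hA.left_comm z t _)
      (by rw [h', ht, hd])).symm

theorem finrank_Q_one_neg_one_le (hn : 3 ≤ n) :
    Module.Finite k (Q (1 : k) (-1) n) ∧ Module.finrank k (Q (1 : k) (-1) n) ≤ n + 1 := by
  have hA := relFree_isQAlgebra (1 : k) (-1) (Fin n)
  choose y z d hd using exists_univ_eq_cons₃ hn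
  let x₀ : Fin n := ⟨0, by omega⟩
  let g := gen (idealQ (1 : k) (-1)) (Fin n)
  have h_mul : ∀ a b c d, associator a (b * c) d = b * associator a c d := fun a b c d => by
    rw [hA.right_symm, associator_mul_right hA.left_comm, hA.right_symm]
  have h_assoc : ∀ {x y z : Fin n} {d : Multiset (Fin n)},
      (Finset.univ : Finset (Fin n)).val = x ::ₘ y ::ₘ z ::ₘ d → ∀ v w : FreeMagma (Fin n),
      x ::ₘ (leaves v + leaves w) = (Finset.univ : Finset (Fin n)).val →
      associator (g x) (FreeMagma.lift g v) (FreeMagma.lift g w) =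
        leftIter hA.left_comm g d (associator (g x) (g y) (g z)) := by
    intro x y z d h v w h'
    refine apply₂_lift_eq_leftIter hA.left_comm (F := associator (g x)) (hA.right_symm _)
      (fun z t w => h_mul _ z t w) (fun z t w => hA.mul_associator_symm w z _ t) ?_
    rwa [h, Multiset.cons_inj_right] at h'
  -- The common value of all multilinear associators with first entry x; `hD` shows that the chosen
  -- y, z, d are immaterial.
  let D : Fin n → RelFree (idealQ (1 : k) (-1)) (Fin n) := fun x =>
    leftIter hA.left_comm g (d x) (associator (g x) (g (y x)) (g (z x)))
  have hD : ∀ {x y z : Fin n} {d : Multiset (Fin n)},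
      (Finset.univ : Finset (Fin n)).val = x ::ₘ y ::ₘ z ::ₘ d →
      leftIter hA.left_comm g d (associator (g x) (g y) (g z)) = D x := by
    intro x' y' z' d' h
    obtain ⟨w, hw⟩ := exists_leaves_eq (Multiset.cons_ne_zero (a := z') (m := d'))
    have hw' : x' ::ₘ (leaves (FreeMagma.of y') + leaves w) =
        (Finset.univ : Finset (Fin n)).val := by
      rw [hw, leaves_of, Multiset.singleton_add, h]
    rw [← h_assoc h _ _ hw', h_assoc (hd x') _ _ hw']
  -- The iterated value of the totally symmetric expression (x,y,z) + y(zx), as `hK` shows.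
  let K : Fin n → RelFree (idealQ (1 : k) (-1)) (Fin n) := fun x =>
    leftIter hA.left_comm g (y x ::ₘ z x ::ₘ d x) (g x) + D x
  have hK : ∀ {x y z : Fin n} {d : Multiset (Fin n)},
      (Finset.univ : Finset (Fin n)).val = x ::ₘ y ::ₘ z ::ₘ d →
      leftIter hA.left_comm g d (associator (g x) (g y) (g z) + g y * (g z * g x)) = K x := by
    intro x' y' z' d' h
    rw [leftIter_add_right, hD h, add_comm]
    have h' := hd x'
    rw [h, Multiset.cons_inj_right] at h'
    change _ = leftIter hA.left_comm g (y x' ::ₘ z x' ::ₘ d x') (g x') + D x'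
    have e : y' ::ₘ z' ::ₘ d' = d' + y' ::ₘ z' ::ₘ 0 := by
      rw [Multiset.add_cons, Multiset.add_cons, add_zero]
    rw [← h', e, leftIter_add, leftIter_cons, leftIter_cons, leftIter_zero]
  have hK' : ∀ x, K x = K x₀ := by
    intro x
    by_cases hx : x = x₀
    · rw [hx]
    obtain ⟨z, d, h⟩ := exists_univ_eq_cons₃_of_ne hn hx
    -- With x and x₀ as the first two labels, their exchange is one instance of `associator_add`.
    rw [← hK h, ← hK (h.trans (Multiset.cons_swap _ _ _)), hA.associator_add]
  have h := finrank_Q_le (fun o : Option (Fin n) => o.elim (K x₀) D) fun t ht => ?_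
  · simpa using h
  have hmem := lift_mem_span_combsAndAssociators k hA.left_comm g h_mul (fun u => ?_) t
  · refine Submodule.span_le.2 ?_ hmem
    have hDmem : ∀ x, D x ∈
        Submodule.span k (Set.range fun o : Option (Fin n) => o.elim (K x₀) D) :=
      fun x => Submodule.subset_span ⟨some x, rfl⟩
    rw [ht]
    rintro a (⟨x', e', h', rfl⟩ | ⟨x', v, w, h', rfl⟩)
    · rw [hd x', Multiset.cons_inj_right] at h'
      have e : leftIter hA.left_comm g e' (g x') = K x₀ - D x' := by
        rw [← hK' x', h']
        exact (add_sub_cancel_right _ _).symm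
      rw [e]
      exact sub_mem (Submodule.subset_span ⟨none, rfl⟩) (hDmem x')
    · rw [h_assoc (hd x') v w h']
      exact hDmem x'
  · induction u using FreeMagma.recOnMul with
    | ih1 x =>
      intro v w
      exact Submodule.subset_span (Or.inr ⟨x, v, w, by
        rw [leaves_of, Multiset.singleton_add, Multiset.cons_add], rfl⟩)
    | ih2 s t hs ht =>
      intro v w
      -- The derivation rule reads (st,v,w) = (t,sv,w) + (s,tv,w), so the first argument shrinks.
      rw [map_mul, hA.associator_derivation, ← h_mul, ← h_mul, ← map_mul, ← map_mul]
      refine add_mem ?_ ?_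
      · convert ht (s * v) w using 3
        simp only [leaves_mul]
        abel
      · convert hs (t * v) w using 3
        simp only [leaves_mul]
        abel

end UpperBound

/-! ### Algebras given by a bilinear product -/

section BilinearAlgebra

variable {k : Type*} [Field k] {V : Type*} [AddCommGroup V] [Module k V]

/-- The algebra with a given bilinear product. -/
def BilinearAlgebra (_β : V →ₗ[k] V →ₗ[k] V) : Type _ := V

variable (β : V →ₗ[k] V →ₗ[k] V)

instance : AddCommGroup (BilinearAlgebra β) := inferInstanceAs (AddCommGroup V)

instance : Module k (BilinearAlgebra β) := inferInstanceAs (Module k V)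

instance : NonUnitalNonAssocRing (BilinearAlgebra β) :=
  { (inferInstance : AddCommGroup (BilinearAlgebra β)) with
    mul := fun a b => β a b
    left_distrib := fun a b c => (β a).map_add b c
    right_distrib := fun a b c => β.map_add₂ a b c
    zero_mul := fun a => β.map_zero₂ a
    mul_zero := fun a => (β a).map_zero }

instance : IsScalarTower k (BilinearAlgebra β) (BilinearAlgebra β) where
  smul_assoc c a b := β.map_smul₂ c a b

instance : SMulCommClass k (BilinearAlgebra β) (BilinearAlgebra β) where
  smul_comm c a b := ((β a).map_smul c b).symm

/-- The value of a monomial in the algebra with a given bilinear product. -/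
def evalTree {X : Type} (b : X → V) (t : FreeMagma X) : V :=
  FreeMagma.lift (β := BilinearAlgebra β) b t

theorem evalTree_of {X : Type} (b : X → V) (x : X) : evalTree β b (FreeMagma.of x) = b x := rfl

theorem evalTree_mul {X : Type} (b : X → V) (s t : FreeMagma X) :
    evalTree β b (s * t) = β (evalTree β b s) (evalTree β b t) := rfl

variable {β}

/-- The symmetric form of the extra identity is easier to check in models. Adding its instances for
(a,c,b) and (b,c,a) gives the original form, in any characteristic. -/
theorem BilinearAlgebra.isQAlgebra {γ δ : k}
    (h₁ : ∀ a b c : V, β (β a b) c - β a (β b c) = β (β a c) b - β a (β c b))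
    (h₂ : ∀ a b c : V, β a (β b c) = β b (β a c))
    (h₃ : ∀ a b c : V, γ • (β (β a b) c - β a (β b c)) - δ • β b (β c a) =
      γ • (β (β b a) c - β b (β a c)) - δ • β a (β c b)) :
    IsQAlgebra γ δ (BilinearAlgebra β) := by
  have h : ∀ a b c : V, γ • ((β (β a b) c - β a (β b c) + (β (β b a) c - β b (β a c))) -
      (β (β c a) b - β c (β a b) + (β (β c b) a - β c (β b a)))) +
      δ • ((β a (β b c) + β b (β a c)) - (β a (β c b) + β b (β c a))) = 0 := by
    intro a b c
    have e₁ := h₃ a c b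
    have e₂ := h₃ b c a
    rw [← h₁ a b c, ← sub_eq_zero] at e₁
    rw [← h₁ b a c, ← sub_eq_zero] at e₂
    have e₃ := congrArg₂ (· + ·) e₁ e₂
    simp only [add_zero] at e₃
    rw [h₂ a c b, h₂ b c a]
    refine Eq.trans ?_ e₃
    module
  exact ⟨h₁, h₂, h⟩

end BilinearAlgebra

/-! ### Lower bounds: three explicit models -/

section LowerBound

variable {k : Type*} [Field k]

/-- Evaluation at b followed by p is a surjection from the operad component. The projection p
discards coordinates irrelevant to the count. -/
theorem finrank_le_finrank_Q {V : Type*} [AddCommGroup V] [Module k V] {β : V →ₗ[k] V →ₗ[k] V}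
    {γ δ : k} (h : IsQAlgebra γ δ (BilinearAlgebra β)) {n : ℕ}
    [Module.Finite k (Q γ δ n)] (b : Fin n → V) {W : Type*} [AddCommGroup W] [Module k W]
    (p : V →ₗ[k] W)
    (hp : Submodule.span k {w | ∃ t : FreeMagma (Fin n),
      leaves t = (Finset.univ : Finset (Fin n)).val ∧ w = p (evalTree β b t)} = ⊤) :
    Module.finrank k W ≤ Module.finrank k (Q γ δ n) := by
  let q : Q γ δ n →ₗ[k] V := evalQ h b
  refine LinearMap.finrank_le_finrank_of_surjective (f := p.comp q) ?_
  rw [← LinearMap.range_eq_top, eq_top_iff, ← hp, Submodule.span_le]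
  rintro _ ⟨t, ht, rfl⟩
  exact ⟨treeClass γ δ t ht, congrArg p (evalQ_treeClass h b t ht)⟩

theorem eq_top_of_single_mem {n : ℕ} {S : Submodule k ((Fin n → k) × k)} {v : Fin n → k}
    (hv : (v, 1) ∈ S) (h : ∀ i, (Pi.single i 1, 0) ∈ S) : S = ⊤ := by
  have h' : ∀ w : Fin n → k, (w, 0) ∈ S := by
    intro w
    have e : (w, (0 : k)) = ∑ i, w i • ((Pi.single i 1, 0) : (Fin n → k) × k) := by
      refine Prod.ext ?_ ?_
      · rw [Prod.fst_sum]
        exact pi_eq_sum_univ' w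
      · rw [Prod.snd_sum]
        simp
    rw [e]
    exact sum_mem fun i _ => S.smul_mem _ (h i)
  rw [eq_top_iff]
  rintro ⟨w, c⟩ -
  have e : (w, c) = (w - c • v, (0 : k)) + c • (v, (1 : k)) := by simp
  rw [e]
  exact add_mem (h' _) (S.smul_mem _ hv)

theorem finrank_pi_prod (n : ℕ) : Module.finrank k ((Fin n → k) × k) = n + 1 := by simp

variable (k) in
/-- The product `x y = λ(x) y + λ(x) λ(y) e`, where `λ` is the sum of coordinates on `kⁿ`, extended
by `λ(e) = 0`. -/
def weightProduct (n : ℕ) :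
    ((Fin n → k) × k) →ₗ[k] ((Fin n → k) × k) →ₗ[k] ((Fin n → k) × k) :=
  let l : (Fin n → k) →ₗ[k] k := ∑ i, LinearMap.proj i
  LinearMap.mk₂ k (fun x y => (l x.1 • y.1, l x.1 * y.2 + l x.1 * l y.1))
    (fun x x' y => Prod.ext (by simp [add_smul]) (by simp; ring))
    (fun c x y => Prod.ext (by simp [mul_smul]) (by simp; ring))
    (fun x y y' => Prod.ext (by simp) (by simp; ring))
    (fun c x y => Prod.ext (by simp [smul_smul, mul_comm]) (by simp; ring))

theorem weightProduct_apply (n : ℕ) (x y : (Fin n → k) × k) :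
    weightProduct k n x y =
      ((∑ i, x.1 i) • y.1, (∑ i, x.1 i) * y.2 + (∑ i, x.1 i) * ∑ i, y.1 i) := by
  simp [weightProduct]

theorem weightProduct_isQAlgebra (n : ℕ) :
    IsQAlgebra (1 : k) 0 (BilinearAlgebra (weightProduct k n)) := by
  refine BilinearAlgebra.isQAlgebra ?_ ?_ ?_ <;> intro a b c <;>
    simp only [weightProduct_apply] <;> ext <;>
    simp [← Finset.mul_sum] <;> ring

theorem sum_evalTree_weightProduct {n : ℕ} (t : FreeMagma (Fin n)) :
    ∑ j, (evalTree (weightProduct k n)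
      (fun i => ((Pi.single i 1, 0) : (Fin n → k) × k)) t).1 j = 1 := by
  induction t using FreeMagma.recOnMul with
  | ih1 x => simp [evalTree_of]
  | ih2 s t hs ht =>
    rw [evalTree_mul, weightProduct_apply]
    simp only [Pi.smul_apply, smul_eq_mul, ← Finset.mul_sum]
    rw [hs, ht, one_mul]

theorem le_finrank_Q_one_zero {n : ℕ} (hn : 3 ≤ n) [Module.Finite k (Q (1 : k) 0 n)] :
    n + 1 ≤ Module.finrank k (Q (1 : k) 0 n) := by
  rw [← finrank_pi_prod (k := k)]
  let b : Fin n → (Fin n → k) × k := fun i =>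
    ((Pi.single i 1, 0) : (Fin n → k) × k)
  refine finrank_le_finrank_Q (weightProduct_isQAlgebra n) b
    (LinearMap.id : ((Fin n → k) × k) →ₗ[k] (Fin n → k) × k) ?_
  -- Since λ is 1 on every monomial, the first entry is the basis vector of the last leaf and the
  -- second counts the steps along the right spine.
  have h_mul : ∀ s t : FreeMagma (Fin n), (evalTree (weightProduct k n) b (s * t)) =
      ((evalTree (weightProduct k n) b t).1, (evalTree (weightProduct k n) b t).2 + 1) := by
    intro s t
    rw [evalTree_mul, weightProduct_apply, sum_evalTree_weightProduct,
      sum_evalTree_weightProduct, one_smul, one_mul, one_mul]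
  set S := Submodule.span k {w | ∃ t : FreeMagma (Fin n),
    leaves t = (Finset.univ : Finset (Fin n)).val ∧
      w = (LinearMap.id : ((Fin n → k) × k) →ₗ[k] (Fin n → k) × k) (evalTree (weightProduct k n) b t)}
  have hS : ∀ t : FreeMagma (Fin n), leaves t = (Finset.univ : Finset (Fin n)).val →
      (evalTree (weightProduct k n) b t : (Fin n → k) × k) ∈ S :=
    fun t ht => Submodule.subset_span ⟨t, ht, rfl⟩
  -- x(yw) and (xy)w have the same last leaf, and their right spines differ by one step.
  have h0 : ((0, 1) : (Fin n → k) × k) ∈ S := by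
    obtain ⟨y, z, d, hd⟩ := exists_univ_eq_cons₃ hn ⟨0, by omega⟩
    generalize (⟨0, by omega⟩ : Fin n) = x at hd
    obtain ⟨w, hw⟩ := exists_leaves_eq (Multiset.cons_ne_zero (a := z) (m := d))
    have h₁ := hS (FreeMagma.of x * (FreeMagma.of y * w)) (by
      rw [hd, ← hw]; simp only [leaves_mul, leaves_of, Multiset.singleton_add])
    have h₂ := hS (FreeMagma.of x * FreeMagma.of y * w) (by
      rw [hd, ← hw]; simp only [leaves_mul, leaves_of, Multiset.singleton_add,
        Multiset.cons_add])
    rw [h_mul, h_mul] at h₁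
    rw [h_mul] at h₂
    convert sub_mem h₁ h₂ using 1
    simp
  refine eq_top_of_single_mem h0 fun i => ?_
  obtain ⟨y, z, d, hd⟩ := exists_univ_eq_cons₃ hn i
  obtain ⟨w, hw⟩ := exists_leaves_eq (Multiset.cons_ne_zero (a := y) (m := z ::ₘ d))
  have h₁ := hS (w * FreeMagma.of i) (by
    rw [hd, ← hw, leaves_mul, leaves_of, add_comm, Multiset.singleton_add])
  rw [h_mul] at h₁
  convert sub_mem h₁ h0 using 1
  refine Prod.ext ?_ ?_
  · exact (sub_zero _).symm
  · change (0 : k) = 0 + 1 - 1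
    ring

variable (k) in
/-- The product `(h, y, c) (h', y', c') = (h y', 0, c c')`. -/
def headProduct (n : ℕ) : ((Fin n → k) × (Fin n → k) × k) →ₗ[k]
    ((Fin n → k) × (Fin n → k) × k) →ₗ[k] ((Fin n → k) × (Fin n → k) × k) :=
  LinearMap.mk₂ k (fun x y => (x.1 * y.2.1, 0, x.2.2 * y.2.2))
    (fun x x' y => by ext <;> simp [add_mul])
    (fun c x y => by ext <;> simp [mul_assoc])
    (fun x y y' => by ext <;> simp [mul_add])
    (fun c x y => by ext <;> simp [mul_left_comm])

theorem headProduct_apply (n : ℕ) (x y : (Fin n → k) × (Fin n → k) × k) :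
    headProduct k n x y = (x.1 * y.2.1, 0, x.2.2 * y.2.2) := rfl

theorem headProduct_isQAlgebra (n : ℕ) :
    IsQAlgebra (0 : k) 1 (BilinearAlgebra (headProduct k n)) := by
  refine BilinearAlgebra.isQAlgebra ?_ ?_ ?_ <;> intro a b c <;>
    simp only [headProduct_apply] <;> ext <;> simp <;> ring

theorem le_finrank_Q_zero_one {n : ℕ} (hn : 3 ≤ n) [Module.Finite k (Q (0 : k) 1 n)] :
    n + 1 ≤ Module.finrank k (Q (0 : k) 1 n) := by
  rw [← finrank_pi_prod (k := k)]
  let V := (Fin n → k) × (Fin n → k) × k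
  -- The factor 1 - e_x fixes e_i for i ≠ x, so a left comb keeps its head. Products have middle
  -- entry 0, so right multiplication by a product kills the head.
  let b : Fin n → V := fun i =>
    ((Pi.single i 1, 1 - Pi.single i 1, 1) : V)
  let p : V →ₗ[k] (Fin n → k) × k :=
    (LinearMap.fst k _ _).prod ((LinearMap.snd k _ _).comp (LinearMap.snd k _ _))
  refine finrank_le_finrank_Q (headProduct_isQAlgebra n) b p ?_
  have h_mul : ∀ s t : FreeMagma (Fin n), (evalTree (headProduct k n) b (s * t)) =
      ((evalTree (headProduct k n) b s).1 * (evalTree (headProduct k n) b t).2.1, 0,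
        (evalTree (headProduct k n) b s).2.2 * (evalTree (headProduct k n) b t).2.2) := fun s t => rfl
  have h_one : ∀ t : FreeMagma (Fin n), (evalTree (headProduct k n) b t).2.2 = 1 := by
    intro t
    induction t using FreeMagma.recOnMul with
    | ih1 x => rfl
    | ih2 s t hs ht => rw [h_mul, hs, ht, one_mul]
  have h_comb : ∀ (i : Fin n) (d : Multiset (Fin n)), i ∉ d → ∃ t : FreeMagma (Fin n),
      leaves t = i ::ₘ d ∧ (evalTree (headProduct k n) b t).1 = Pi.single i 1 := by
    intro i d hi
    induction d using Multiset.induction with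
    | empty => exact ⟨FreeMagma.of i, rfl, rfl⟩
    | cons x d ih =>
      rw [Multiset.mem_cons, not_or] at hi
      obtain ⟨t, ht, ht'⟩ := ih hi.2
      refine ⟨t * FreeMagma.of x, ?_, ?_⟩
      · rw [leaves_mul, ht, leaves_of, add_comm, Multiset.singleton_add, Multiset.cons_swap]
      · rw [h_mul, ht']
        change (Pi.single i 1 : Fin n → k) * (1 - Pi.single x 1) = _
        rw [mul_sub, mul_one, sub_eq_self]
        funext j
        by_cases hj : j = i
        · subst hj
          simp [Pi.single_eq_of_ne hi.1]
        · simp [Pi.single_eq_of_ne hj]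
  set S := Submodule.span k {w | ∃ t : FreeMagma (Fin n),
    leaves t = (Finset.univ : Finset (Fin n)).val ∧ w = p (evalTree (headProduct k n) b t)}
  have hS : ∀ t : FreeMagma (Fin n), leaves t = (Finset.univ : Finset (Fin n)).val →
      ((evalTree (headProduct k n) b t).1, (1 : k)) ∈ S := by
    intro t ht
    rw [← h_one t]
    exact Submodule.subset_span ⟨t, ht, rfl⟩
  have h0 : ((0, 1) : (Fin n → k) × k) ∈ S := by
    obtain ⟨y, z, d, hd⟩ := exists_univ_eq_cons₃ hn ⟨0, by omega⟩
    generalize (⟨0, by omega⟩ : Fin n) = x at hd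
    obtain ⟨w, hw⟩ := exists_leaves_eq (Multiset.cons_ne_zero (a := z) (m := d))
    have h₁ := hS (FreeMagma.of x * (FreeMagma.of y * w)) (by
      rw [hd, ← hw]; simp only [leaves_mul, leaves_of, Multiset.singleton_add])
    rwa [h_mul, h_mul, mul_zero] at h₁
  refine eq_top_of_single_mem h0 fun i => ?_
  obtain ⟨d, hd⟩ := Multiset.exists_cons_of_mem (Finset.mem_univ_val i)
  have hi : i ∉ d := by
    have := (Finset.univ : Finset (Fin n)).nodup
    rw [hd] at this
    exact (Multiset.nodup_cons.1 this).1
  obtain ⟨t, ht, ht'⟩ := h_comb i d hi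
  have h₁ := hS t (ht.trans hd.symm)
  rw [ht'] at h₁
  convert sub_mem h₁ h0 using 1
  simp

variable (k) in
/-- The product `(a, h, e) (a', h', e') = (a a', a h' + a' h, a e' + a' e + a' h)`. -/
def depthProduct (n : ℕ) : (k × (Fin n → k) × (Fin n → k)) →ₗ[k]
    (k × (Fin n → k) × (Fin n → k)) →ₗ[k] (k × (Fin n → k) × (Fin n → k)) :=
  LinearMap.mk₂ k (fun x y => (x.1 * y.1, x.1 • y.2.1 + y.1 • x.2.1,
      x.1 • y.2.2 + y.1 • x.2.2 + y.1 • x.2.1))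
    (fun x x' y => by ext <;> simp <;> ring)
    (fun c x y => by ext <;> simp <;> ring)
    (fun x y y' => by ext <;> simp <;> ring)
    (fun c x y => by ext <;> simp <;> ring)

theorem depthProduct_apply (n : ℕ) (x y : k × (Fin n → k) × (Fin n → k)) :
    depthProduct k n x y = (x.1 * y.1, x.1 • y.2.1 + y.1 • x.2.1,
      x.1 • y.2.2 + y.1 • x.2.2 + y.1 • x.2.1) := rfl

theorem depthProduct_isQAlgebra (n : ℕ) :
    IsQAlgebra (1 : k) (-1) (BilinearAlgebra (depthProduct k n)) := by
  refine BilinearAlgebra.isQAlgebra ?_ ?_ ?_ <;> intro a b c <;>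
    simp only [depthProduct_apply] <;> ext <;> simp <;> ring

theorem le_finrank_Q_one_neg_one {n : ℕ} (hn : 3 ≤ n) [Module.Finite k (Q (1 : k) (-1) n)] :
    n + 1 ≤ Module.finrank k (Q (1 : k) (-1) n) := by
  rw [← finrank_pi_prod (k := k)]
  let V := k × (Fin n → k) × (Fin n → k)
  let b : Fin n → V := fun i => ((1, Pi.single i 1, 0) : V)
  let p : V →ₗ[k] (Fin n → k) × k :=
    ((LinearMap.snd k _ _).comp (LinearMap.snd k _ _)).prod (LinearMap.fst k _ _)
  refine finrank_le_finrank_Q (depthProduct_isQAlgebra n) b p ?_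
  have h_one : ∀ t : FreeMagma (Fin n), (evalTree (depthProduct k n) b t).1 = 1 := by
    intro t
    induction t using FreeMagma.recOnMul with
    | ih1 x => rfl
    | ih2 s t hs ht =>
      rw [evalTree_mul, depthProduct_apply, hs, ht, one_mul]
  -- The middle entry is the sum of the leaf vectors, and the last entry gains that of the left
  -- factor at each node: it records the left depth of every leaf.
  have h_mul : ∀ s t : FreeMagma (Fin n), (evalTree (depthProduct k n) b (s * t)) =
      (1, (evalTree (depthProduct k n) b t).2.1 + (evalTree (depthProduct k n) b s).2.1,
        (evalTree (depthProduct k n) b t).2.2 + (evalTree (depthProduct k n) b s).2.2 +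
          (evalTree (depthProduct k n) b s).2.1) := by
    intro s t
    rw [evalTree_mul, depthProduct_apply, h_one, h_one]
    simp only [one_mul, one_smul]
  set S := Submodule.span k {w | ∃ t : FreeMagma (Fin n),
    leaves t = (Finset.univ : Finset (Fin n)).val ∧ w = p (evalTree (depthProduct k n) b t)}
  have hS : ∀ t : FreeMagma (Fin n), leaves t = (Finset.univ : Finset (Fin n)).val →
      ((evalTree (depthProduct k n) b t).2.2, (1 : k)) ∈ S := by
    intro t ht
    rw [← h_one t]
    exact Submodule.subset_span ⟨t, ht, rfl⟩
  obtain ⟨t, ht⟩ := exists_leaves_eq (d := (Finset.univ : Finset (Fin n)).val) (by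
    obtain ⟨y, z, d, hd⟩ := exists_univ_eq_cons₃ hn ⟨0, by omega⟩
    rw [hd]
    exact Multiset.cons_ne_zero)
  refine eq_top_of_single_mem (hS t ht) fun i => ?_
  obtain ⟨y, z, d, hd⟩ := exists_univ_eq_cons₃ hn i
  obtain ⟨w, hw⟩ := exists_leaves_eq (Multiset.cons_ne_zero (a := z) (m := d))
  -- In (iy)w the leaf i has left depth one more than in i(yw), and all other left depths agree; the
  -- difference is e_i.
  have h₁ := hS (FreeMagma.of i * (FreeMagma.of y * w)) (by
    rw [hd, ← hw]; simp only [leaves_mul, leaves_of, Multiset.singleton_add])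
  have h₂ := hS (FreeMagma.of i * FreeMagma.of y * w) (by
    rw [hd, ← hw]; simp only [leaves_mul, leaves_of, Multiset.singleton_add,
      Multiset.cons_add])
  convert sub_mem h₂ h₁ using 1
  simp only [h_mul, Prod.mk_sub_mk, sub_self, Prod.mk.injEq, and_true]
  have hb : ∀ j, (evalTree (depthProduct k n) b (FreeMagma.of j)) = (1, Pi.single j 1, 0) := fun j => rfl
  rw [hb, hb]
  simp only
  abel

end LowerBound

end

end NovOperad

theorem corollaryC4 (k : Type*) [Field k] [CharZero k] (n : ℕ) (hn : 3 ≤ n) :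
    Module.finrank k (NovOperad.Q (1 : k) (-1) n) = n + 1 ∧
    Module.finrank k (NovOperad.Q (1 : k) 0 n) = n + 1 ∧
    Module.finrank k (NovOperad.Q (0 : k) 1 n) = n + 1 := by
  -- The finiteness component is kept for the lower bounds: `finrank` is 0 on infinite-dimensional
  -- spaces, so a surjection alone would bound nothing.
  obtain ⟨_, h₁⟩ := NovOperad.finrank_Q_one_neg_one_le (k := k) hn
  obtain ⟨_, h₂⟩ := NovOperad.finrank_Q_one_zero_le (k := k) hn
  obtain ⟨_, h₃⟩ := NovOperad.finrank_Q_zero_one_le (k := k) hn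
  exact ⟨h₁.antisymm (NovOperad.le_finrank_Q_one_neg_one hn),
    h₂.antisymm (NovOperad.le_finrank_Q_one_zero hn),
    h₃.antisymm (NovOperad.le_finrank_Q_zero_one hn)⟩
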